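/- **Setting.** Buyers' valuations $V_1,V_2,\dots$ are i.i.d. with $\mathbb P(V_t=v_i)=p_i>0$ for $i=1,\dots,K$, where $K\ge 1$, $0<v_1<\dots<v_K\le 1$ and $\sum_i p_i=1$. In round $t$ the seller posts a price $X_t\in[0,1]$, which may depend only on the earlier prices and feedback, earns $r_t(X_t)$, where $r_t(x)=x\,\mathbb 1\{V_t\ge x\}$, and observes only the bit $\mathbb 1\{V_t\ge X_t\}$. The regret is $R_T=\max_{x\in[0,1]}\mathbb E\big[\sum_{t=1}^T (r_t(x)-r_t(X_t))\big]$. **Algorithm** (inputs: a horizon $T\in\mathbb N$ and $\delta\in(0,1)$; $K$, the $v_i$ and the $p_i$ are unknown to it). It stores intervals $[a_i,b_i]$, $i=1,\dots,k$, a set $\mathcal K\subseteq\{1,\dots,k\}$ of live intervals, and a demand estimate $\overline D(x)$ at each price $x$ offered so far. Initially $k=1$, $\mathcal K=\{1\}$, $[a_1,b_1]=[0,1]$, $\overline D(0)=1$, $\overline D(1)=0$, and $a_0=1$ is a sentinel. *Search phase.* While some $j\in\mathcal K$ has $b_j-a_j>T^{-1/2}$, let $i$ be the smallest such $j$, let $x=(a_i+b_i)/2$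 and $\theta=\frac12(k/T)^{1/4}$, offer $x$ for $\lceil 8\sqrt{T/k}\,\ln\delta^{-1}\rceil$ rounds, and let $\overline D(x)$ be the fraction of accepted offers. (1) If $\overline D(a_i)-\overline D(x)<\theta$: when $\overline D(x)-\overline D(b_i)\ge\theta$, set $a_i\gets x$; otherwise remove $i$ from $\mathcal K$. (2) If $\overline D(a_i)-\overline D(x)\ge\theta$: when $\overline D(x)-\overline D(a_j)\ge\theta$ for all $j\in\{0,\dots,k\}$ with $a_j>x$, create a new live interval $[a_{k+1},b_{k+1}]=[x,b_i]$ and increase $k$ by one; in either case set $b_i\gets x$. *Bandit phase.* For the rounds that remain, run UCB1 on the prices $\{a_j\}_{j\in\mathcal K}$: play each arm once, then play an arm maximizing (average revenue of the arm) $+\sqrt{2\ln n/n_j}$, where $n_j$ is the number of plays of arm $j$ and $n$ the total number of plays in this phase. (Ties go to the smallest index; if $\mathcal K=\varnothing$, post the price $0$.) The algorithm is stopped after $T$ rounds, in whichever phase it is. **Theorem.** There are universal constants $C$ and $q$ such that, for every $T\ge 2$ and every instance $(v_1,p_1),\dots,(v_K,p_K)$, the regret of this algorithm run with $\delta=T^{-2}$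 satisfies $$R_T\le C\sqrt{KT}\,(\ln T)^q+V(V+1),\qquad V=\max_{1\le i\le K}\frac{v_K^4}{(v_i-v_{i-1})^5},\quad v_0=0,$$ and also the sharper bound $$R_T\le C\sqrt{KT}\,(\ln T)^q+K\,\frac{v_K^4}{v_1^4}\Big(1+\frac{v_K^4}{c^4}\Big),\qquad c=\min_{2\le i\le K}(v_i-v_{i-1})$$ (for $K=1$, $c=\infty$ and the last factor is $1$). -/

import Mathlib

open MeasureTheory ProbabilityTheory

noncomputable section

namespace PostedPrice

/-! ### The stochastic posted price problem -/

/-- An instance with `K = n + 1` valuations `0 < v 0 < ⋯ < v n ≤ 1`, where the valuation `v i` has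
probability `p i > 0`. (The valuation called `v i` here is the `(i + 1)`-st smallest one.) -/
structure Instance (n : ℕ) where
  v : Fin (n + 1) → ℝ
  p : Fin (n + 1) → ℝ
  v_pos : 0 < v 0
  v_strictMono : StrictMono v
  v_le_one : v (Fin.last n) ≤ 1
  p_pos : ∀ i, 0 < p i
  p_sum : ∑ i, p i = 1

/-- `V 0, V 1, …` are i.i.d. buyers' valuations, distributed according to the instance. -/
structure IsIIDValuations {n : ℕ} (I : Instance n) {Ω : Type*} [MeasurableSpace Ω]
    (μ : Measure Ω) (V : ℕ → Ω → ℝ) : Prop where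
  measurable : ∀ t, Measurable (V t)
  indep : iIndepFun V μ
  law : ∀ t i, μ {ω | V t ω = I.v i} = ENNReal.ofReal (I.p i)

/-- The revenue of price `x` when the buyer's valuation is `w`. -/
def revenue (x w : ℝ) : ℝ := if x ≤ w then x else 0

/-- A deterministic seller, presented as a machine: it posts the price that its current state
prescribes and updates the state with the binary feedback (`true`: the good was sold). -/
structure Seller where
  State : Type
  init : State
  price : State → ℝ
  next : State → Bool → State

/-- The state of the seller before round `t`, when the buyers' valuations are `w 0, w 1, …`. -/
def Seller.stateAt (S : Seller) (w : ℕ → ℝ) : ℕ → S.State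
  | 0 => S.init
  | t + 1 => S.next (S.stateAt w t) (decide (S.price (S.stateAt w t) ≤ w t))

/-- The price posted in round `t`. -/
def Seller.priceAt (S : Seller) (w : ℕ → ℝ) (t : ℕ) : ℝ := S.price (S.stateAt w t)

/-- The regret after `T` rounds: the maximum over the fixed prices `x ∈ [0, 1]` of the expected
difference between the revenue of `x` and the revenue of the seller. -/
def regret (S : Seller) {Ω : Type*} [MeasurableSpace Ω] (μ : Measure Ω) (V : ℕ → Ω → ℝ)
    (T : ℕ) : ℝ :=
  ⨆ x : Set.Icc (0 : ℝ) 1,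
    ∫ ω, ∑ t ∈ Finset.range T,
      (revenue x (V t ω) - revenue (S.priceAt (fun s => V s ω) t) (V t ω)) ∂μ

/-! ### The algorithm -/

/-- The variables of the search phase: the number `k` of intervals allocated so far (they are
numbered `1, …, k`), the set of the intervals that have not been removed, the endpoints
`[a i, b i]`, and the last estimate `D x` of the demand at price `x`. -/
structure SearchState where
  k : ℕ
  live : Finset ℕ
  a : ℕ → ℝ
  b : ℕ → ℝ
  D : ℝ → ℝ

/-- One interval `[0, 1]`. The demand is known to be `1` at price `0`, and it counts as `0` at the
right end `1` (nothing is sold above `1`); the point `a 0 = 1` is a sentinel for this fact. The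
values of `D` at other prices are never read before they have been set. -/
def SearchState.init : SearchState where
  k := 1
  live := {1}
  a := fun i => if i = 0 then 1 else 0
  b := fun _ => 1
  D := fun x => if x = 0 then 1 else 0

/-- The remaining intervals that are longer than `T ^ (-1/2)`. -/
def SearchState.wide (T : ℕ) (s : SearchState) : Finset ℕ :=
  open Classical in s.live.filter fun j => (T : ℝ) ^ (-(1 / 2) : ℝ) < s.b j - s.a j

/-- The index of the interval that is searched next (used only when `wide` is nonempty). -/
def SearchState.pick (T : ℕ) (s : SearchState) : ℕ := sInf (s.wide T : Set ℕ)

/-- The price offered in the next macrostep: the midpoint of the selected interval. -/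
def SearchState.mid (T : ℕ) (s : SearchState) : ℝ := (s.a (s.pick T) + s.b (s.pick T)) / 2

/-- The number of rounds of the next macrostep. -/
def SearchState.macroLength (T : ℕ) (δ : ℝ) (s : SearchState) : ℕ :=
  ⌈8 * √((T : ℝ) / s.k) * Real.log δ⁻¹⌉₊

/-- The threshold of the demand comparisons. -/
def SearchState.threshold (T : ℕ) (s : SearchState) : ℝ := ((s.k : ℝ) / T) ^ (1 / 4 : ℝ) / 2

/-- The update at the end of a macrostep in which a fraction `d` of the offers was accepted. -/
def SearchState.update (T : ℕ) (s : SearchState) (d : ℝ) : SearchState :=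
  open Classical in
  let i := s.pick T
  let x := s.mid T
  let θ := s.threshold T
  let D := Function.update s.D x d
  if D (s.a i) - D x < θ then
    -- undershooting: keep the upper half, unless the interval is a fake arm
    if θ ≤ D x - D (s.b i) then
      { s with D := D, a := Function.update s.a i x }
    else
      { s with D := D, live := s.live.erase i }
  else
    -- overshooting: keep the lower half; the upper half becomes a new interval if the demand at
    -- `x` is significantly larger than at every stored point to the right of `x`
    if ∀ j ∈ Finset.range (s.k + 1), x < s.a j → θ ≤ D x - D (s.a j) then
      { k := s.k + 1
        live := insert (s.k + 1) s.live
        a := Function.update s.a (s.k + 1) x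
        b := Function.update (Function.update s.b (s.k + 1) (s.b i)) i x
        D := D }
    else
      { s with D := D, b := Function.update s.b i x }

/-- The UCB1 choice among the arms in `live`, when arm `j` has been played `N j` times with total
reward `G j`: an arm that has not been played, if there is one, and otherwise a maximizer of
`G j / N j + √(2 log n / N j)`, where `n` is the total number of plays so far. Ties are broken by
the smallest index. -/
def ucbArm (live : Finset ℕ) (N : ℕ → ℕ) (G : ℕ → ℝ) : ℕ :=
  open Classical in
  let n : ℕ := ∑ j ∈ live, N j
  let idx : ℕ → ℝ := fun j => G j / N j + √(2 * Real.log n / N j)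
  if ∃ j ∈ live, N j = 0 then sInf {j | j ∈ live ∧ N j = 0}
  else sInf {j | j ∈ live ∧ ∀ i ∈ live, idx i ≤ idx j}

/-- The state of the algorithm: in the search phase, with the numbers of offers and of sales so far
in the current macrostep, or in the bandit phase, with the numbers of plays and the total rewards
of the arms. -/
inductive AlgState where
  | search (s : SearchState) (offers sales : ℕ)
  | bandit (s : SearchState) (N : ℕ → ℕ) (G : ℕ → ℝ)

/-- Start the next macrostep, or the bandit phase if all remaining intervals are short. -/
def AlgState.enter (T : ℕ) (s : SearchState) : AlgState :=
  open Classical in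
  if (s.wide T).Nonempty then .search s 0 0 else .bandit s (fun _ => 0) (fun _ => 0)

/-- The price posted in a given state. (If the search phase has removed all intervals, there is no
arm to play, and the price `0` is posted.) -/
def AlgState.price (T : ℕ) : AlgState → ℝ
  | .search s _ _ => s.mid T
  | .bandit s N G => if s.live = ∅ then 0 else s.a (ucbArm s.live N G)

/-- The update of the state with the feedback of one round. -/
def AlgState.next (T : ℕ) (δ : ℝ) : AlgState → Bool → AlgState
  | .search s offers sales, sold =>
      let sales' := if sold then sales + 1 else sales
      if s.macroLength T δ ≤ offers + 1 then
        AlgState.enter T (s.update T ((sales' : ℝ) / ((offers + 1 : ℕ) : ℝ)))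
      else .search s (offers + 1) sales'
  | .bandit s N G, sold =>
      let j := ucbArm s.live N G
      .bandit s (Function.update N j (N j + 1))
        (Function.update G j (G j + if sold then s.a j else 0))

/-- Binary search for the valuations, followed by UCB1 on the left endpoints of the intervals
found. The only inputs are the horizon `T` and the confidence parameter `δ`. -/
def searchThenUCB (T : ℕ) (δ : ℝ) : Seller where
  State := AlgState
  init := AlgState.enter T SearchState.init
  price := AlgState.price T
  next := AlgState.next T δ

/-! ### The additive constants -/

/-- The smallest valuation. -/
def Instance.vMin {n : ℕ} (I : Instance n) : ℝ := I.v 0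

/-- The largest valuation. -/
def Instance.vMax {n : ℕ} (I : Instance n) : ℝ := I.v (Fin.last n)

/-- The difference between the `i`-th valuation and the preceding one, where the valuation that
precedes the smallest one is `0`. -/
def Instance.gap {n : ℕ} (I : Instance n) (i : Fin (n + 1)) : ℝ :=
  I.v i - Fin.cases (motive := fun _ => ℝ) 0 (fun j : Fin n => I.v j.castSucc) i

/-- The maximum over all `i` of `v_K ^ 4 / (v_i - v_{i-1}) ^ 5`. -/
def Instance.bigV {n : ℕ} (I : Instance n) : ℝ :=
  Finset.univ.sup' Finset.univ_nonempty fun i => I.vMax ^ 4 / I.gap i ^ 5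

/-- The smallest difference between two consecutive valuations (for at least two valuations). -/
def Instance.minGap {n : ℕ} (I : Instance n) : ℝ := ⨅ j : Fin n, (I.v j.succ - I.v j.castSucc)

/-- `K (v_K / v_1) ^ 4 (1 + v_K ^ 4 / c ^ 4)`, where `c` is the smallest difference between two
consecutive valuations. For a single valuation `c = ∞`, so that the last factor is `1`. -/
def Instance.sharpConstant {n : ℕ} (I : Instance n) : ℝ :=
  (n + 1) * (I.vMax / I.vMin) ^ 4 * (1 + if n = 0 then 0 else I.vMax ^ 4 / I.minGap ^ 4)

end PostedPrice

end

/-! Write `K = n + 1` and let `D` be the demand function. A price depends only on earlier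
valuations, which are independent of the current one, so the expected regret obeys a recursion over
the remaining rounds and the state in which only `D` enters (`IsIIDValuations.regret_le`). From
there on, "with high probability" is expressed by exponential supermartingales that are functions of
the state. They do not increase in expectation, start small, and are at least 1 when an estimate is
bad, so that, multiplied by the possible loss, they can be added to a regret bound proved by
induction on the rounds.

Let `v o` maximize `v * D v` over the valuations, and suppose first that `p o ≥ (K / T) ^ (1/4)`.
This is at least twice the threshold `θ` while `k ≤ K`. If all estimates have error below `θ / 2`,
an observed drop of `θ` certifies a true drop of the demand, and a true drop of `p o` is always
observed. Hence (`Invariant.update`) the stored left endpoints have distinct demands, which forces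
`k ≤ K`, and an interval around `v o` stays alive. An interval is halved `O(log T)` times, and a
macrostep with `k` intervals takes about `√(T / k) log T` rounds. Charging it to the halved interval
`i ≤ k` gives a total of order `log² T ∑ √(T / i)`, hence `√(K T) log² T`
(`Invariant.searchCost_update`). Finally `v o` exceeds the left endpoint `a` of its interval by at
most `T ^ (-1/2)`, and `a` sells at least as often, so always posting `a` loses at most `√T`. UCB1
on at most `K` arms loses `O(√(K T log T) + K)` against `a` (`expectedRegret_bandit_le`).

If `p o` is smaller, compare `v o` with the lowest valuation and with the next higher one:
optimality bounds `p o` below in terms of the valuations alone. Then `T` is at most the additive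
constant (`horizon_le_sharpConstant`), and the trivial bound `T` for the regret suffices. -/

noncomputable section

namespace PostedPrice

/-! ### Expected revenue by backward recursion -/

/-- The demand at price `x`: the probability that a buyer accepts the price `x`. -/
def Instance.demand {n : ℕ} (I : Instance n) (x : ℝ) : ℝ := ∑ i, if x ≤ I.v i then I.p i else 0

/-- The expected revenue in `t` rounds of a machine in a given state, when a price `x` is accepted
with probability `D x`. -/
def expectedRevenue {σ : Type*} (price : σ → ℝ) (next : σ → Bool → σ) (D : ℝ → ℝ) : ℕ → σ → ℝ
  | 0, _ => 0
  | t + 1, s => D (price s) * (price s + expectedRevenue price next D t (next s true))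
      + (1 - D (price s)) * expectedRevenue price next D t (next s false)

/-- The expected regret in `t` rounds of a machine in a given state, with respect to a benchmark
that earns `r` in each round. -/
def expectedRegret {σ : Type*} (price : σ → ℝ) (next : σ → Bool → σ) (D : ℝ → ℝ) (r : ℝ) :
    ℕ → σ → ℝ
  | 0, _ => 0
  | t + 1, s => r - price s * D (price s)
      + D (price s) * expectedRegret price next D r t (next s true)
      + (1 - D (price s)) * expectedRegret price next D r t (next s false)

theorem expectedRegret_eq {σ : Type*} (price : σ → ℝ) (next : σ → Bool → σ) (D : ℝ → ℝ) (r : ℝ)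
    (t : ℕ) (s : σ) :
    expectedRegret price next D r t s = t * r - expectedRevenue price next D t s := by
  induction t generalizing s with
  | zero => simp [expectedRegret, expectedRevenue]
  | succ t ih =>
    simp only [expectedRegret, expectedRevenue, ih]
    push_cast
    ring

/-- The revenue in `t` rounds of a machine in a given state, when the buyers' valuations are
`w 0, w 1, …`. -/
def realizedRevenue {σ : Type*} (price : σ → ℝ) (next : σ → Bool → σ) : ℕ → σ → (ℕ → ℝ) → ℝ
  | 0, _, _ => 0
  | t + 1, s, w => revenue (price s) (w 0)
      + realizedRevenue price next t (next s (decide (price s ≤ w 0))) (fun i => w (i + 1))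

theorem sum_revenue_eq_realizedRevenue (S : Seller) (w : ℕ → ℝ) (T : ℕ) :
    ∑ t ∈ Finset.range T, revenue (S.priceAt w t) (w t)
      = realizedRevenue S.price S.next T S.init w := by
  -- The recursion shifts the valuations, so the induction needs an arbitrary starting round `s`.
  suffices h : ∀ (T s : ℕ), ∑ t ∈ Finset.range T, revenue (S.priceAt w (s + t)) (w (s + t))
      = realizedRevenue S.price S.next T (S.stateAt w s) (fun i => w (s + i)) by
    simpa [Seller.stateAt] using h T 0
  intro T
  induction T with
  | zero => intro s; simp [realizedRevenue]
  | succ T ih =>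
    intro s
    rw [Finset.sum_range_succ', add_comm]
    have := ih (s + 1)
    simp only [realizedRevenue, Seller.priceAt, add_zero] at this ⊢
    congr 1
    simp only [Seller.stateAt] at this
    simpa only [add_assoc, add_comm, add_left_comm] using this

/-- Both summands are products of a function of the first valuation and a function of the later
ones, the form in which independence applies. -/
theorem realizedRevenue_succ {σ : Type*} (price : σ → ℝ) (next : σ → Bool → σ) (t : ℕ) (s : σ)
    (w : ℕ → ℝ) :
    realizedRevenue price next (t + 1) s w
      = (Set.Ici (price s)).indicator 1 (w 0)
          * (price s + realizedRevenue price next t (next s true) (fun i => w (i + 1)))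
        + (1 - (Set.Ici (price s)).indicator 1 (w 0))
          * realizedRevenue price next t (next s false) (fun i => w (i + 1)) := by
  by_cases h : price s ≤ w 0 <;> simp [realizedRevenue, revenue, h]

/-- For a fixed initial state only finitely many feedback sequences matter, so the state space needs
no measurable structure. -/
theorem measurable_realizedRevenue {σ : Type*} (price : σ → ℝ) (next : σ → Bool → σ) (t : ℕ)
    (s : σ) : Measurable (realizedRevenue price next t s) := by
  induction t generalizing s with
  | zero => exact measurable_const
  | succ t ih =>
    have hs : Measurable fun w : ℕ → ℝ => fun i => w (i + 1) := by fun_prop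
    have hi : Measurable fun w : ℕ → ℝ => (Set.Ici (price s)).indicator (1 : ℝ → ℝ) (w 0) :=
      (measurable_one.indicator measurableSet_Ici).comp (measurable_pi_apply 0)
    have h1 := (ih (next s true)).comp hs
    have h2 := (ih (next s false)).comp hs
    have : realizedRevenue price next (t + 1) s = _ := funext (realizedRevenue_succ price next t s)
    rw [this]
    exact (hi.mul (measurable_const.add h1)).add ((measurable_const.sub hi).mul h2)

theorem exists_abs_realizedRevenue_le {σ : Type*} (price : σ → ℝ) (next : σ → Bool → σ) (t : ℕ)
    (s : σ) : ∃ C, ∀ w, |realizedRevenue price next t s w| ≤ C := by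
  induction t generalizing s with
  | zero => exact ⟨0, by simp [realizedRevenue]⟩
  | succ t ih =>
    obtain ⟨C₁, h₁⟩ := ih (next s true)
    obtain ⟨C₂, h₂⟩ := ih (next s false)
    refine ⟨|price s| + C₁ + C₂, fun w => ?_⟩
    rw [realizedRevenue_succ]
    have h1 := h₁ (fun i => w (i + 1))
    have h2 := h₂ (fun i => w (i + 1))
    have h3 := abs_add_le (price s) (realizedRevenue price next t (next s true) fun i => w (i + 1))
    have := abs_nonneg (price s)
    by_cases h : price s ≤ w 0
    · simp [h]
      linarith [abs_nonneg (realizedRevenue price next t (next s false) fun i => w (i + 1))]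
    · simp [h]
      linarith [abs_nonneg (realizedRevenue price next t (next s true) fun i => w (i + 1))]

/-! ### From i.i.d. valuations to the recursion -/

section IID

variable {n : ℕ} {I : Instance n} {Ω : Type*} [MeasurableSpace Ω] {μ : Measure Ω}
  {V : ℕ → Ω → ℝ}

theorem IsIIDValuations.indepFun_future (h : IsIIDValuations I μ V) (s : ℕ) :
    IndepFun (V s) (fun ω i => V (s + 1 + i) ω) μ := by
  rw [IndepFun_iff_Indep]
  have hd : Disjoint ({s} : Set ℕ) (Set.Ioi s) := by simp
  have := indep_iSup_of_disjoint (fun i => (h.measurable i).comap_le) h.indep.iIndep hd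
  refine indep_of_indep_of_le_left (indep_of_indep_of_le_right this ?_) ?_
  · rw [← measurable_iff_comap_le]
    refine @measurable_pi_lambda _ _ _ (_) _ _ fun i => ?_
    rw [measurable_iff_comap_le]
    exact le_iSup₂_of_le (s + 1 + i) (by simp; omega) le_rfl
  · simp

variable [IsProbabilityMeasure μ]

theorem IsIIDValuations.integral_indicator (h : IsIIDValuations I μ V) (s : ℕ) (x : ℝ) :
    ∫ ω, (Set.Ici x).indicator (1 : ℝ → ℝ) (V s ω) ∂μ = I.demand x := by
  have hm : ∀ i, MeasurableSet {ω | V s ω = I.v i} := fun i =>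
    h.measurable s (measurableSet_singleton (I.v i))
  have hr : ∀ i, μ.real {ω | V s ω = I.v i} = I.p i := fun i => by
    rw [Measure.real, h.law, ENNReal.toReal_ofReal (I.p_pos i).le]
  have hint : ∀ (g : Fin (n + 1) → ℝ), ∫ ω, ∑ i, {ω | V s ω = I.v i}.indicator (fun _ => g i) ω ∂μ
      = ∑ i, I.p i * g i := by
    intro g
    rw [integral_finsetSum _ fun i _ => (integrable_const _).indicator (hm i)]
    refine Finset.sum_congr rfl fun i _ => ?_
    rw [integral_indicator_const _ (hm i), hr, smul_eq_mul]
  have hsum : ∀ (g : Fin (n + 1) → ℝ) (ω : Ω) (i : Fin (n + 1)), V s ω = I.v i →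
      ∑ j, {ω | V s ω = I.v j}.indicator (fun _ => g j) ω = g i := by
    intro g ω i hi
    rw [Finset.sum_eq_single i]
    · simp [hi]
    · intro j _ hj
      simp [hi, I.v_strictMono.injective.eq_iff, hj.symm]
    · simp
  -- The law prescribes only point masses, but these sum to 1, so no other value has positive
  -- probability.
  have hae : ∀ᵐ ω ∂μ, ∃ i, V s ω = I.v i := by
    have hU : {ω | ∃ i, V s ω = I.v i} = ⋃ i, {ω | V s ω = I.v i} := by ext; simp
    have hms : MeasurableSet {ω | ∃ i, V s ω = I.v i} := hU ▸ MeasurableSet.iUnion hm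
    refine (mem_ae_iff_prob_eq_one hms).2 ?_
    rw [hU, measure_iUnion (fun i j hij => ?_) hm, tsum_fintype]
    · simp only [h.law]
      rw [← ENNReal.ofReal_sum_of_nonneg fun i _ => (I.p_pos i).le, I.p_sum, ENNReal.ofReal_one]
    · refine Set.disjoint_left.2 fun ω hi hj => hij ?_
      exact I.v_strictMono.injective (hi.symm.trans hj)
  rw [integral_congr_ae (g := fun ω => ∑ i, {ω | V s ω = I.v i}.indicator
    (fun _ => if x ≤ I.v i then (1 : ℝ) else 0) ω), hint]
  · simp [Instance.demand]
  · filter_upwards [hae] with ω ⟨i, hi⟩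
    rw [hsum _ ω i hi, hi]
    simp [Set.indicator]

/-- The state `q` is deterministic, so acceptance in round `s` depends on `V s` alone and is
independent of all that follows. The induction restarts at `s + 1` from either successor state. -/
theorem IsIIDValuations.integral_realizedRevenue (h : IsIIDValuations I μ V) {σ : Type*}
    (price : σ → ℝ) (next : σ → Bool → σ) (t s : ℕ) (q : σ) :
    ∫ ω, realizedRevenue price next t q (fun i => V (s + i) ω) ∂μ
      = expectedRevenue price next I.demand t q := by
  induction t generalizing s q with
  | zero => simp [realizedRevenue, expectedRevenue]
  | succ t ih =>
    have hV : Measurable fun ω i => V (s + 1 + i) ω :=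
      measurable_pi_lambda _ fun i => h.measurable _
    have hi : Measurable ((Set.Ici (price q)).indicator (1 : ℝ → ℝ)) :=
      measurable_one.indicator measurableSet_Ici
    have hF : ∀ q', Measurable fun ω => realizedRevenue price next t q' fun i => V (s + 1 + i) ω :=
      fun q' => (measurable_realizedRevenue price next t q').comp hV
    have hFi : ∀ q', Integrable
        (fun ω => realizedRevenue price next t q' fun i => V (s + 1 + i) ω) μ := by
      intro q'
      obtain ⟨C, hC⟩ := exists_abs_realizedRevenue_le price next t q'
      exact Integrable.of_bound (hF q').aestronglyMeasurable C (ae_of_all _ fun ω => hC _)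
    have hX : Measurable fun ω => (Set.Ici (price q)).indicator (1 : ℝ → ℝ) (V s ω) :=
      hi.comp (h.measurable s)
    have hXb : ∀ ω, ‖(Set.Ici (price q)).indicator (1 : ℝ → ℝ) (V s ω)‖ ≤ 1 := fun ω => by
      by_cases h : price q ≤ V s ω <;> simp [h]
    have hXi : Integrable (fun ω => (Set.Ici (price q)).indicator (1 : ℝ → ℝ) (V s ω)) μ :=
      Integrable.of_bound hX.aestronglyMeasurable 1 (ae_of_all _ hXb)
    have hG : Measurable fun w => price q + realizedRevenue price next t (next q true) w :=
      measurable_const.add (measurable_realizedRevenue price next t _)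
    have e1 := ((h.indepFun_future s).comp hi hG).integral_fun_mul_eq_mul_integral
      hX.aestronglyMeasurable (hG.comp hV).aestronglyMeasurable
    have e2 := ((h.indepFun_future s).comp (measurable_const.sub hi)
      (measurable_realizedRevenue price next t (next q false))).integral_fun_mul_eq_mul_integral
      (measurable_const.sub hX).aestronglyMeasurable (hF _).aestronglyMeasurable (𝕜 := ℝ)
      (X := (fun v => 1 - (Set.Ici (price q)).indicator (1 : ℝ → ℝ) v) ∘ V s)
    have hi1 : Integrable (fun ω => (Set.Ici (price q)).indicator (1 : ℝ → ℝ) (V s ω)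
        * (price q + realizedRevenue price next t (next q true) fun i => V (s + 1 + i) ω)) μ :=
      ((integrable_const _).add (hFi _)).bdd_mul hX.aestronglyMeasurable (ae_of_all _ hXb)
    have hi2 : Integrable (fun ω => (1 - (Set.Ici (price q)).indicator (1 : ℝ → ℝ) (V s ω))
        * (realizedRevenue price next t (next q false) fun i => V (s + 1 + i) ω)) μ :=
      (hFi _).bdd_mul (c := 1) (measurable_const.sub hX).aestronglyMeasurable
        (ae_of_all _ fun ω => by by_cases h : price q ≤ V s ω <;> simp [h])
    simp only [realizedRevenue_succ, add_zero, expectedRevenue]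
    have hre : ∀ ω, (fun i => V (s + (i + 1)) ω) = fun i => V (s + 1 + i) ω := fun ω => by
      funext i
      rw [add_assoc, add_comm 1 i]
    simp only [hre]
    rw [integral_add hi1 hi2]
    simp only [Function.comp_def] at e1 e2
    rw [e1, e2, integral_sub (integrable_const _) hXi, integral_add (integrable_const _) (hFi _),
      ih, ih, h.integral_indicator]
    simp

theorem IsIIDValuations.integrable_revenue (h : IsIIDValuations I μ V) (x : ℝ) (t : ℕ) :
    Integrable (fun ω => revenue x (V t ω)) μ := by
  refine Integrable.of_bound (C := |x|) (Measurable.aestronglyMeasurable ?_)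
    (ae_of_all _ fun ω => ?_)
  · exact Measurable.ite (h.measurable t measurableSet_Ici) measurable_const measurable_const
  · by_cases hx : x ≤ V t ω <;> simp [revenue, hx]

theorem IsIIDValuations.integral_revenue (h : IsIIDValuations I μ V) (x : ℝ) (t : ℕ) :
    ∫ ω, revenue x (V t ω) ∂μ = x * I.demand x := by
  rw [← h.integral_indicator t x, ← integral_const_mul]
  refine integral_congr_ae (ae_of_all _ fun ω => ?_)
  by_cases hx : x ≤ V t ω <;> simp [revenue, hx]

/-- The regret is at most the expected regret with respect to any upper bound for the expected
revenues of the fixed prices. -/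
theorem IsIIDValuations.regret_le (h : IsIIDValuations I μ V) (S : Seller) (T : ℕ) {r : ℝ}
    (hr : ∀ x, 0 ≤ x → x ≤ 1 → x * I.demand x ≤ r) :
    regret S μ V T ≤ expectedRegret S.price S.next I.demand r T S.init := by
  have : Nonempty (Set.Icc (0 : ℝ) 1) := ⟨⟨0, by simp⟩⟩
  refine ciSup_le fun x => ?_
  have hS : Integrable (fun ω => realizedRevenue S.price S.next T S.init fun s => V s ω) μ := by
    obtain ⟨C, hC⟩ := exists_abs_realizedRevenue_le S.price S.next T S.init
    exact Integrable.of_bound ((measurable_realizedRevenue S.price S.next T S.init).comp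
      (measurable_pi_lambda _ fun i => h.measurable i)).aestronglyMeasurable C
      (ae_of_all _ fun ω => hC _)
  have hJ := h.integral_realizedRevenue S.price S.next T 0 S.init
  simp only [zero_add] at hJ
  simp only [Finset.sum_sub_distrib]
  simp only [sum_revenue_eq_realizedRevenue S (fun s => V s _)]
  rw [integral_sub (integrable_finsetSum _ fun t _ => h.integrable_revenue x t) hS, hJ,
    integral_finsetSum _ fun t _ => h.integrable_revenue x t, expectedRegret_eq]
  simp only [h.integral_revenue, Finset.sum_const, Finset.card_range, nsmul_eq_mul]
  gcongr
  exact hr x x.2.1 x.2.2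

end IID

/-! ### Concentration -/

/-- Hoeffding's lemma for a Bernoulli variable. -/
theorem bernoulli_exp_le {q : ℝ} (h0 : 0 ≤ q) (h1 : q ≤ 1) (l : ℝ) :
    q * Real.exp (l * (1 - q)) + (1 - q) * Real.exp (-(l * q)) ≤ Real.exp (l ^ 2 / 8) := by
  let μ : Measure ℝ := ENNReal.ofReal q • Measure.dirac 1 + ENNReal.ofReal (1 - q) • Measure.dirac 0
  have : IsProbabilityMeasure μ := ⟨by
    simp only [μ, Measure.add_apply, Measure.smul_apply, measure_univ, smul_eq_mul, mul_one]
    rw [← ENNReal.ofReal_add h0 (by linarith)]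
    simp⟩
  have hint : ∀ f : ℝ → ℝ, Measurable f → ∫ x, f x ∂μ = q * f 1 + (1 - q) * f 0 := by
    intro f hf
    rw [integral_add_measure]
    · simp [integral_smul_measure, h0, h1]
    · exact (integrable_dirac (by simp)).smul_measure ENNReal.ofReal_ne_top
    · exact (integrable_dirac (by simp)).smul_measure ENNReal.ofReal_ne_top
  have hb : ∀ᵐ x ∂μ, (id x : ℝ) ∈ Set.Icc (0 : ℝ) 1 := by
    rw [ae_iff]
    simp [μ]
  have h := (hasSubgaussianMGF_of_mem_Icc (μ := μ) aemeasurable_id hb).mgf_le l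
  rw [mgf, hint _ (by fun_prop)] at h
  have hmean : ∫ x, id x ∂μ = q := by rw [hint _ measurable_id]; simp
  rw [hmean] at h
  convert h using 2
  · simp
  · simp
  · simp
    ring

/-- The expectation of a two-sided exponential bound for a centred Bernoulli variable. -/
theorem bernoulli_exp_step {q : ℝ} (h0 : 0 ≤ q) (h1 : q ≤ 1) (l z e : ℝ) :
    q * Real.exp (z + l * (1 - q) + e) + (1 - q) * Real.exp (z - l * q + e)
      ≤ Real.exp (z + (e + l ^ 2 / 8)) := by
  have h := mul_le_mul_of_nonneg_left (bernoulli_exp_le h0 h1 l) (Real.exp_pos (z + e)).le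
  rw [← Real.exp_add] at h
  calc _ = Real.exp (z + e) * (q * Real.exp (l * (1 - q)) + (1 - q) * Real.exp (-(l * q))) := by
        rw [mul_add, mul_left_comm, mul_left_comm _ (1 - q), ← Real.exp_add, ← Real.exp_add]
        ring_nf
    _ ≤ _ := h
    _ = _ := by ring_nf

/-- An exponential supermartingale that bounds the probability that the mean of `m` Bernoulli
variables with parameter `q` deviates from `q` by at least `ε`, after `o` variables with sum `c`. -/
def deviationBound (m : ℕ) (q ε : ℝ) (o c : ℕ) : ℝ :=
  Real.exp (4 * ε * (c - q * o) + (m - o) * (2 * ε ^ 2) - 4 * ε ^ 2 * m)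
    + Real.exp (-(4 * ε) * (c - q * o) + (m - o) * (2 * ε ^ 2) - 4 * ε ^ 2 * m)

theorem deviationBound_nonneg (m : ℕ) (q ε : ℝ) (o c : ℕ) : 0 ≤ deviationBound m q ε o c := by
  unfold deviationBound; positivity

/-- Both exponents use the slope `l = 4 ε`, which is optimal in Hoeffding's bound. Each variable
still to come is charged in advance `l ^ 2 / 8 = 2 ε ^ 2`, exactly what Hoeffding's lemma costs. -/
theorem deviationBound_step {q : ℝ} (h0 : 0 ≤ q) (h1 : q ≤ 1) (m : ℕ) (ε : ℝ) (o c : ℕ) :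
    q * deviationBound m q ε (o + 1) (c + 1) + (1 - q) * deviationBound m q ε (o + 1) c
      ≤ deviationBound m q ε o c := by
  have a := bernoulli_exp_step h0 h1 (4 * ε) (4 * ε * (c - q * o))
    ((m - (o + 1)) * (2 * ε ^ 2) - 4 * ε ^ 2 * m)
  have b := bernoulli_exp_step h0 h1 (-(4 * ε)) (-(4 * ε) * (c - q * o))
    ((m - (o + 1)) * (2 * ε ^ 2) - 4 * ε ^ 2 * m)
  unfold deviationBound
  push_cast
  ring_nf at a b ⊢
  linarith

/-- At `o = m` the larger exponent is `4 ε (|c - q m| - ε m)`. -/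
theorem one_le_deviationBound {m : ℕ} (hm : 0 < m) {q ε : ℝ} (hε : 0 < ε) {c : ℕ}
    (h : ε ≤ |(c : ℝ) / m - q|) : 1 ≤ deviationBound m q ε m c := by
  have hm' : (0 : ℝ) < m := by exact_mod_cast hm
  have key : (c : ℝ) - q * m = ((c : ℝ) / m - q) * m := by field_simp
  unfold deviationBound
  rw [key]
  rcases le_abs.1 h with h | h
  · have : 1 ≤ Real.exp (4 * ε * (((c : ℝ) / m - q) * m) + (m - m) * (2 * ε ^ 2)
        - 4 * ε ^ 2 * m) := by
      apply Real.one_le_exp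
      nlinarith [mul_nonneg (mul_nonneg hε.le hm'.le) (sub_nonneg.2 h)]
    linarith [Real.exp_pos (-(4 * ε) * (((c : ℝ) / m - q) * m) + (m - m) * (2 * ε ^ 2)
        - 4 * ε ^ 2 * m)]
  · have : 1 ≤ Real.exp (-(4 * ε) * (((c : ℝ) / m - q) * m) + (m - m) * (2 * ε ^ 2)
        - 4 * ε ^ 2 * m) := by
      apply Real.one_le_exp
      nlinarith [mul_nonneg (mul_nonneg hε.le hm'.le) (sub_nonneg.2 h)]
    linarith [Real.exp_pos (4 * ε * (((c : ℝ) / m - q) * m) + (m - m) * (2 * ε ^ 2)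
        - 4 * ε ^ 2 * m)]

theorem deviationBound_zero (m : ℕ) (q ε : ℝ) :
    deviationBound m q ε 0 0 = 2 * Real.exp (-(2 * ε ^ 2 * m)) := by
  simp only [deviationBound]
  push_cast
  ring_nf

/-! ### The bandit phase -/

theorem sum_eq_add_sub_of_eq_off {ι : Type*} {A : Finset ι} {F F' : ι → ℝ} {j : ι} (hj : j ∈ A)
    (h : ∀ i ∈ A, i ≠ j → F' i = F i) : ∑ i ∈ A, F' i = ∑ i ∈ A, F i + (F' j - F j) := by
  classical
  rw [← Finset.add_sum_erase _ _ hj, ← Finset.add_sum_erase _ F hj,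
    Finset.sum_congr rfl fun i hi => h i (Finset.mem_of_mem_erase hi) (Finset.ne_of_mem_erase hi)]
  ring

/-- An exponential supermartingale that is at least `1` if after `N = M` plays the total reward of
an arm deviates from its mean by at least `M √(2 log n / M)`; `d` is the deviation. -/
def ucbDeviation (n M N : ℕ) (d : ℝ) : ℝ :=
  Real.exp (4 * √(2 * Real.log n / M) * d + (-(N * (4 * √(2 * Real.log n / M)) ^ 2 / 8)
      - 4 * Real.log n))
    + Real.exp (-(4 * √(2 * Real.log n / M)) * d + (-(N * (4 * √(2 * Real.log n / M)) ^ 2 / 8)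
      - 4 * Real.log n))

theorem ucbDeviation_nonneg (n M N : ℕ) (d : ℝ) : 0 ≤ ucbDeviation n M N d := by
  unfold ucbDeviation; positivity

theorem ucbDeviation_step {q a : ℝ} (h0 : 0 ≤ q) (h1 : q ≤ 1) (ha0 : 0 ≤ a) (ha1 : a ≤ 1)
    (n M N : ℕ) (d : ℝ) :
    q * ucbDeviation n M (N + 1) (d + a * (1 - q)) + (1 - q) * ucbDeviation n M (N + 1) (d - a * q)
      ≤ ucbDeviation n M N d := by
  have main : ∀ l e : ℝ, q * Real.exp (l * (d + a * (1 - q)) + (-((N + 1) * l ^ 2 / 8) - e))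
      + (1 - q) * Real.exp (l * (d - a * q) + (-((N + 1) * l ^ 2 / 8) - e))
      ≤ Real.exp (l * d + (-(N * l ^ 2 / 8) - e)) := by
    intro l e
    have h := bernoulli_exp_step h0 h1 (l * a) (l * d) (-((N + 1) * l ^ 2 / 8) - e)
    calc _ = q * Real.exp (l * d + l * a * (1 - q) + (-((N + 1) * l ^ 2 / 8) - e))
          + (1 - q) * Real.exp (l * d - l * a * q + (-((N + 1) * l ^ 2 / 8) - e)) := by ring_nf
      _ ≤ _ := h
      _ ≤ _ := by
        rw [Real.exp_le_exp]
        -- A sale pays `a ≤ 1`, so the slope `l a` costs no more than the `l ^ 2 / 8` set aside for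
        -- a play.
        have : (l * a) ^ 2 ≤ l ^ 2 := by
          rw [mul_pow]
          exact mul_le_of_le_one_right (sq_nonneg l) (pow_le_one₀ ha0 ha1)
        linarith
  have p := main (4 * √(2 * Real.log n / M)) (4 * Real.log n)
  have m := main (-(4 * √(2 * Real.log n / M))) (4 * Real.log n)
  rw [neg_sq] at m
  unfold ucbDeviation
  push_cast
  linarith

/-- With `s` the radius and `s ^ 2 * M = 2 log n`, the exponent at `|d| = M s` is `8 log n - 4 log n
- 4 log n = 0`. -/
theorem one_le_ucbDeviation {n M : ℕ} (hM : 0 < M) {d : ℝ}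
    (h : M * √(2 * Real.log n / M) ≤ |d|) : 1 ≤ ucbDeviation n M M d := by
  have hM' : (0 : ℝ) < M := by exact_mod_cast hM
  set s := √(2 * Real.log n / M) with hs
  have hs0 : 0 ≤ s := Real.sqrt_nonneg _
  have hss : s ^ 2 * M = 2 * Real.log n := by
    rw [hs, Real.sq_sqrt (div_nonneg (mul_nonneg (by norm_num) (Real.log_natCast_nonneg n)) hM'.le)]
    field_simp
  unfold ucbDeviation
  rw [← hs]
  have key : ∀ x : ℝ, M * s ≤ x → 0 ≤ 4 * s * x + (-(M * (4 * s) ^ 2 / 8) - 4 * Real.log n) := by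
    intro x hx
    nlinarith [mul_le_mul_of_nonneg_left hx hs0]
  rcases le_abs.1 h with h | h
  · have := Real.one_le_exp (key d h)
    linarith [Real.exp_pos (-(4 * s) * d + (-(M * (4 * s) ^ 2 / 8) - 4 * Real.log n))]
  · have := Real.one_le_exp (key (-d) h)
    rw [mul_neg, ← neg_mul] at this
    linarith [Real.exp_pos (4 * s * d + (-(M * (4 * s) ^ 2 / 8) - 4 * Real.log n))]

/-- The sum of the deviation bounds over all arms and all numbers of plays up to `n`. -/
def ucbFailure (A : Finset ℕ) (m : ℕ → ℝ) (n : ℕ) (N : ℕ → ℕ) (G : ℕ → ℝ) : ℝ :=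
  ∑ j ∈ A, ∑ M ∈ Finset.Icc 1 n, ucbDeviation n M (N j) (G j - N j * m j)

theorem ucbFailure_nonneg (A : Finset ℕ) (m : ℕ → ℝ) (n : ℕ) (N : ℕ → ℕ) (G : ℕ → ℝ) :
    0 ≤ ucbFailure A m n N G :=
  Finset.sum_nonneg fun _ _ => Finset.sum_nonneg fun _ _ => ucbDeviation_nonneg _ _ _ _

/-- A union bound over `n` play counts, each with two tails of size `n ^ (-4)`. -/
theorem ucbFailure_zero (A : Finset ℕ) (m : ℕ → ℝ) {n : ℕ} (hn : 0 < n) :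
    ucbFailure A m n (fun _ => 0) (fun _ => 0) = A.card * (2 / (n : ℝ) ^ 3) := by
  have hn' : (0 : ℝ) < n := by exact_mod_cast hn
  have h4 : Real.exp (-(4 * Real.log n)) = 1 / (n : ℝ) ^ 4 := by
    rw [Real.exp_neg, mul_comm, Real.exp_mul, Real.exp_log hn', one_div]
    norm_cast
  have : ∀ M, ucbDeviation n M 0 0 = 2 * (1 / (n : ℝ) ^ 4) := by
    intro M
    rw [← h4]
    simp [ucbDeviation]
    ring
  simp only [ucbFailure, Nat.cast_zero, zero_mul, sub_zero, this, Finset.sum_const, Nat.card_Icc,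
    nsmul_eq_mul, Nat.add_sub_cancel]
  field_simp

theorem ucbFailure_step {A : Finset ℕ} {a q : ℕ → ℝ} (hq0 : ∀ j, 0 ≤ q j) (hq1 : ∀ j, q j ≤ 1)
    (ha0 : ∀ j ∈ A, 0 ≤ a j) (ha1 : ∀ j ∈ A, a j ≤ 1) (n : ℕ) (N : ℕ → ℕ) (G : ℕ → ℝ) {j : ℕ}
    (hj : j ∈ A) :
    q j * ucbFailure A (fun i => a i * q i) n (Function.update N j (N j + 1))
          (Function.update G j (G j + a j))
        + (1 - q j) * ucbFailure A (fun i => a i * q i) n (Function.update N j (N j + 1))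
          (Function.update G j (G j + 0))
      ≤ ucbFailure A (fun i => a i * q i) n N G := by
  have key : ∀ g, ucbFailure A (fun i => a i * q i) n (Function.update N j (N j + 1))
      (Function.update G j g) = ucbFailure A (fun i => a i * q i) n N G
        + (∑ M ∈ Finset.Icc 1 n, ucbDeviation n M (N j + 1) (g - (N j + 1 : ℕ) * (a j * q j))
          - ∑ M ∈ Finset.Icc 1 n, ucbDeviation n M (N j) (G j - N j * (a j * q j))) := by
    intro g
    unfold ucbFailure
    rw [sum_eq_add_sub_of_eq_off (F := fun j => ∑ M ∈ Finset.Icc 1 n,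
      ucbDeviation n M (N j) (G j - N j * (a j * q j))) hj]
    · simp only [Function.update_self]
    · intro i _ hi; simp [hi]
  rw [key, key]
  have := Finset.sum_le_sum fun M (_ : M ∈ Finset.Icc 1 n) =>
    ucbDeviation_step (hq0 j) (hq1 j) (ha0 j hj) (ha1 j hj) n M (N j) (G j - N j * (a j * q j))
  rw [Finset.sum_add_distrib, ← Finset.mul_sum, ← Finset.mul_sum] at this
  have e1 : G j - N j * (a j * q j) + a j * (1 - q j)
      = G j + a j - ((N j + 1 : ℕ) : ℝ) * (a j * q j) := by push_cast; ring
  have e2 : G j - N j * (a j * q j) - a j * q j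
      = G j + 0 - ((N j + 1 : ℕ) : ℝ) * (a j * q j) := by push_cast; ring
  rw [e1, e2] at this
  linarith

theorem ucbArm_mem {A : Finset ℕ} (hA : A.Nonempty) (N : ℕ → ℕ) (G : ℕ → ℝ) :
    ucbArm A N G ∈ A := by
  classical
  unfold ucbArm
  split_ifs with h
  · exact (Nat.sInf_mem (s := {j | j ∈ A ∧ N j = 0}) h).1
  · obtain ⟨j, hj, hm⟩ := A.exists_max_image
      (fun j => G j / N j + √(2 * Real.log (∑ j ∈ A, N j : ℕ) / N j)) hA
    exact (Nat.sInf_mem (s := {j | j ∈ A ∧ ∀ i ∈ A, _ ≤ _}) ⟨j, hj, hm⟩).1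

theorem ucbArm_unplayed {A : Finset ℕ} {N : ℕ → ℕ} (G : ℕ → ℝ) (h : ∃ j ∈ A, N j = 0) :
    N (ucbArm A N G) = 0 := by
  unfold ucbArm
  rw [if_pos h]
  exact (Nat.sInf_mem (s := {j | j ∈ A ∧ N j = 0}) h).2

theorem le_ucbArm {A : Finset ℕ} (hA : A.Nonempty) {N : ℕ → ℕ} (G : ℕ → ℝ)
    (h : ¬ ∃ j ∈ A, N j = 0) {i : ℕ} (hi : i ∈ A) :
    G i / N i + √(2 * Real.log (∑ j ∈ A, N j : ℕ) / N i)
      ≤ G (ucbArm A N G) / N (ucbArm A N G)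
        + √(2 * Real.log (∑ j ∈ A, N j : ℕ) / N (ucbArm A N G)) := by
  classical
  unfold ucbArm
  simp only [if_neg h]
  obtain ⟨j, hj, hm⟩ := A.exists_max_image
    (fun j => G j / N j + √(2 * Real.log (∑ j ∈ A, N j : ℕ) / N j)) hA
  exact (Nat.sInf_mem (s := {j | j ∈ A ∧ ∀ i ∈ A,
    G i / N i + √(2 * Real.log (∑ j ∈ A, N j : ℕ) / N i)
      ≤ G j / N j + √(2 * Real.log (∑ j ∈ A, N j : ℕ) / N j)}) ⟨j, hj, hm⟩).2 i hi

/-- The difference of the roots is `1 / (√(N + 1) + √N)`, and `√(N + 1) ≤ √2 * √N`. -/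
theorem inv_sqrt_le_sqrt_succ_sub {N : ℝ} (hN : 1 ≤ N) :
    1 / √N ≤ 2 * √2 * (√(N + 1) - √N) := by
  have hu : 0 < √N := Real.sqrt_pos.2 (by linarith)
  have hv : √(N + 1) ≤ √2 * √N := by
    rw [← Real.sqrt_mul (by norm_num)]
    exact Real.sqrt_le_sqrt (by linarith)
  have h2 : 1 ≤ √2 := Real.one_le_sqrt.2 (by norm_num)
  have hd : (√(N + 1) - √N) * (√(N + 1) + √N) = 1 := by
    have h1 := Real.sq_sqrt (show 0 ≤ N + 1 by linarith)
    have h2 := Real.sq_sqrt (show 0 ≤ N by linarith)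
    nlinarith
  have hp : 0 ≤ √(N + 1) - √N := sub_nonneg.2 (Real.sqrt_le_sqrt (by linarith))
  rw [div_le_iff₀ hu]
  nlinarith [mul_le_mul_of_nonneg_right h2 hu.le]

/-- Twice the confidence radius becomes an increment of `√N`, so that the regret telescopes along
the plays of an arm. -/
theorem sqrt_two_log_div_le {N n T : ℕ} (hN : 1 ≤ N) (hn : 1 ≤ n) (hnT : n ≤ T) :
    2 * √(2 * Real.log n / N) ≤ 8 * √(Real.log T) * (√((N + 1 : ℕ) : ℝ) - √(N : ℝ)) := by
  have hN' : (1 : ℝ) ≤ N := by exact_mod_cast hN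
  have hl : Real.log n ≤ Real.log T :=
    Real.log_le_log (by exact_mod_cast hn) (by exact_mod_cast hnT)
  have h1 : √(2 * Real.log n / N) ≤ √2 * √(Real.log T) * (1 / √N) := by
    rw [Real.sqrt_div' _ (by linarith), Real.sqrt_mul (by norm_num), mul_one_div]
    gcongr
  have h2 := mul_le_mul_of_nonneg_left (inv_sqrt_le_sqrt_succ_sub hN')
    (show 0 ≤ √2 * √(Real.log T) by positivity)
  have h3 : √2 * √2 = 2 := Real.mul_self_sqrt (by norm_num)
  push_cast
  calc _ ≤ 2 * (√2 * √(Real.log T) * (2 * √2 * (√((N : ℝ) + 1) - √(N : ℝ)))) := by linarith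
    _ = 4 * (√2 * √2) * √(Real.log T) * (√((N : ℝ) + 1) - √(N : ℝ)) := by ring
    _ = _ := by rw [h3]; ring

/-- The regret of one UCB1 round with respect to a fixed arm. -/
theorem ucb_round_le {A : Finset ℕ} {m : ℕ → ℝ} (hm0 : ∀ j ∈ A, 0 ≤ m j) (hm1 : ∀ j ∈ A, m j ≤ 1)
    {N : ℕ → ℕ} {G : ℕ → ℝ} {T : ℕ} (hT : ∑ j ∈ A, N j ≤ T) {i : ℕ} (hi : i ∈ A) :
    m i - m (ucbArm A N G) ≤ (if N (ucbArm A N G) = 0 then 1 else 0)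
      + 8 * √(Real.log T) * (√((N (ucbArm A N G) + 1 : ℕ) : ℝ) - √(N (ucbArm A N G) : ℝ))
      + ucbFailure A m (∑ j ∈ A, N j) N G := by
  have hj := ucbArm_mem ⟨i, hi⟩ N G
  have hF := ucbFailure_nonneg A m (∑ j ∈ A, N j) N G
  have hle : m i - m (ucbArm A N G) ≤ 1 := by linarith [hm1 i hi, hm0 _ hj]
  have hs : 0 ≤ 8 * √(Real.log T)
      * (√((N (ucbArm A N G) + 1 : ℕ) : ℝ) - √(N (ucbArm A N G) : ℝ)) :=
    mul_nonneg (by positivity) (sub_nonneg.2 (Real.sqrt_le_sqrt (by push_cast; linarith)))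
  by_cases h : ∃ j ∈ A, N j = 0
  · rw [if_pos (ucbArm_unplayed G h)]
    linarith
  -- A failure term of at least 1 pays for the whole round; below 1, every arm lies within its
  -- confidence radius.
  by_cases hF1 : 1 ≤ ucbFailure A m (∑ j ∈ A, N j) N G
  · split_ifs <;> linarith
  set n := ∑ j ∈ A, N j with hn
  have hpos : ∀ j ∈ A, 1 ≤ N j := fun j hj => by
    have : N j ≠ 0 := fun h0 => h ⟨j, hj, h0⟩
    omega
  have hNn : ∀ j ∈ A, N j ≤ n := fun j hj =>
    Finset.single_le_sum (f := N) (fun _ _ => Nat.zero_le _) hj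
  have hdev : ∀ j ∈ A, |G j - N j * m j| < N j * √(2 * Real.log n / N j) := by
    intro j hj
    by_contra hc
    refine hF1 ((one_le_ucbDeviation (hpos j hj) (not_lt.1 hc)).trans ?_)
    refine le_trans ?_ (Finset.single_le_sum (f := fun j => ∑ M ∈ Finset.Icc 1 n,
      ucbDeviation n M (N j) (G j - N j * m j))
      (fun _ _ => Finset.sum_nonneg fun _ _ => ucbDeviation_nonneg _ _ _ _) hj)
    exact Finset.single_le_sum (f := fun M => ucbDeviation n M (N j) (G j - N j * m j))
      (fun _ _ => ucbDeviation_nonneg _ _ _ _) (Finset.mem_Icc.2 ⟨hpos j hj, hNn j hj⟩)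
  have hdev' : ∀ j ∈ A, |G j / N j - m j| < √(2 * Real.log n / N j) := by
    intro j hj
    have hp : (0 : ℝ) < N j := by exact_mod_cast hpos j hj
    have e : G j - N j * m j = N j * (G j / N j - m j) := by field_simp
    have := hdev j hj
    rw [e, abs_mul, abs_of_pos hp] at this
    exact lt_of_mul_lt_mul_left this hp.le
  -- The mean of `i` is below its index, which is at most the index of the chosen arm, which is
  -- below that arm's mean plus two radii.
  have d1 := abs_lt.1 (hdev' i hi)
  have d2 := abs_lt.1 (hdev' _ hj)
  have d3 := le_ucbArm ⟨i, hi⟩ G h hi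
  have d4 := sqrt_two_log_div_le (hpos _ hj) ((hpos _ hj).trans (hNn _ hj)) hT
  rw [← hn] at d3
  split_ifs <;> linarith [d1.1, d2.2]

/-- Cauchy–Schwarz. It makes the square-root term of the potential nonnegative when no rounds
remain. -/
theorem sum_sqrt_le (A : Finset ℕ) (N : ℕ → ℕ) :
    ∑ j ∈ A, √(N j : ℝ) ≤ √((A.card : ℝ) * (∑ j ∈ A, N j : ℕ)) := by
  refine Real.le_sqrt_of_sq_le ?_
  refine sq_sum_le_card_mul_sum_sq.trans (le_of_eq ?_)
  push_cast
  congr 1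
  exact Finset.sum_congr rfl fun j _ => Real.sq_sqrt (Nat.cast_nonneg _)

/-- The expected regret of the bandit phase, from any intermediate state. -/
theorem expectedRegret_bandit_le_potential {T : ℕ} {δ : ℝ} {D : ℝ → ℝ} (hD0 : ∀ x, 0 ≤ D x)
    (hD1 : ∀ x, D x ≤ 1) {s : SearchState} (ha0 : ∀ j ∈ s.live, 0 ≤ s.a j)
    (ha1 : ∀ j ∈ s.live, s.a j ≤ 1) {i : ℕ} (hi : i ∈ s.live) (r : ℝ) (t : ℕ) (N : ℕ → ℕ)
    (G : ℕ → ℝ) (ht : ∑ j ∈ s.live, N j + t ≤ T) :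
    expectedRegret (AlgState.price T) (AlgState.next T δ) D r t (.bandit s N G)
      ≤ t * (r - s.a i * D (s.a i)) + (∑ j ∈ s.live, if N j = 0 then (1 : ℝ) else 0)
        + 8 * √(Real.log T)
          * (√((s.live.card : ℝ) * (∑ j ∈ s.live, N j + t : ℕ)) - ∑ j ∈ s.live, √(N j : ℝ))
        + ∑ n ∈ Finset.Ico (∑ j ∈ s.live, N j) (∑ j ∈ s.live, N j + t),
          ucbFailure s.live (fun j => s.a j * D (s.a j)) n N G := by
  induction t generalizing N G with
  | zero =>
    simp only [expectedRegret, Nat.cast_zero, zero_mul, add_zero, Finset.Ico_self,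
      Finset.sum_empty, zero_add]
    have h1 : (0 : ℝ) ≤ ∑ j ∈ s.live, if N j = 0 then (1 : ℝ) else 0 :=
      Finset.sum_nonneg fun _ _ => by split_ifs <;> norm_num
    have h2 := mul_nonneg (show 0 ≤ 8 * √(Real.log T) by positivity)
      (sub_nonneg.2 (sum_sqrt_le s.live N))
    linarith
  | succ t ih =>
    set A := s.live
    set m : ℕ → ℝ := fun j => s.a j * D (s.a j) with hm
    set j := ucbArm A N G with hjdef
    have hj : j ∈ A := ucbArm_mem ⟨i, hi⟩ N G
    have hround := ucb_round_le (A := A) (m := m) (N := N) (G := G) (T := T)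
      (fun j hj => mul_nonneg (ha0 j hj) (hD0 _))
      (fun j hj => mul_le_one₀ (ha1 j hj) (hD0 _) (hD1 _)) (by omega) hi
    rw [← hjdef] at hround
    set N' := Function.update N j (N j + 1) with hN'
    have hsumN : ∑ l ∈ A, N' l = ∑ l ∈ A, N l + 1 := by
      rw [← Finset.add_sum_erase _ _ hj, ← Finset.add_sum_erase _ N hj,
        Finset.sum_congr rfl fun l hl => by
          rw [hN', Function.update_of_ne (Finset.ne_of_mem_erase hl)]]
      simp [hN']
      ring
    have hun : (∑ l ∈ A, if N' l = 0 then (1 : ℝ) else 0)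
        = (∑ l ∈ A, if N l = 0 then (1 : ℝ) else 0) - (if N j = 0 then 1 else 0) := by
      rw [sum_eq_add_sub_of_eq_off (F := fun l => if N l = 0 then (1 : ℝ) else 0) hj]
      · simp [hN']; ring
      · intro l _ hl; simp [hN', hl]
    have hsq : ∑ l ∈ A, √(N' l : ℝ)
        = ∑ l ∈ A, √(N l : ℝ) + (√((N j + 1 : ℕ) : ℝ) - √(N j : ℝ)) := by
      rw [sum_eq_add_sub_of_eq_off (F := fun l => √(N l : ℝ)) hj]
      · simp [hN']
      · intro l _ hl; simp [hN', hl]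
    have hnext : ∀ sold, AlgState.next T δ (.bandit s N G) sold
        = .bandit s N' (Function.update G j (G j + if sold then s.a j else 0)) := fun _ => rfl
    have hprice : AlgState.price T (.bandit s N G) = s.a j := by
      simp only [AlgState.price]
      rw [if_neg (Finset.ne_empty_of_mem hi)]
    simp only [expectedRegret, hnext, hprice]
    have i1 := ih N' (Function.update G j (G j + s.a j)) (by omega)
    have i2 := ih N' (Function.update G j (G j + 0)) (by omega)
    rw [hsumN, hun, hsq, show ∑ l ∈ A, N l + 1 + t = ∑ l ∈ A, N l + (t + 1) by ring] at i1 i2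
    -- The failure term of the current play count pays for this round; the later ones are passed on
    -- by the supermartingale property.
    rw [Finset.sum_eq_sum_Ico_succ_bot (by omega)]
    have hF := Finset.sum_le_sum fun n
      (_ : n ∈ Finset.Ico (∑ l ∈ A, N l + 1) (∑ l ∈ A, N l + (t + 1))) =>
      ucbFailure_step (a := s.a) (q := fun j => D (s.a j)) (fun _ => hD0 _) (fun _ => hD1 _)
        ha0 ha1 n N G hj
    rw [Finset.sum_add_distrib, ← Finset.mul_sum, ← Finset.mul_sum] at hF
    have j1 := mul_le_mul_of_nonneg_left i1 (hD0 (s.a j))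
    have j2 := mul_le_mul_of_nonneg_left i2 (sub_nonneg.2 (hD1 (s.a j)))
    simp only [if_true, Bool.false_eq_true, if_false]
    push_cast at j1 j2 hround ⊢
    simp only [hm] at hround j1 j2 ⊢
    rw [← hN'] at hF
    linarith

/-- Telescoping with `1 / t - 1 / (t + 1)`. The terms with denominator 0 are 0 by convention. -/
theorem sum_inv_cube_le (t : ℕ) :
    ∑ n ∈ Finset.range (t + 1), 1 / (n : ℝ) ^ 3 ≤ 2 - 1 / (t : ℝ) := by
  induction t with
  | zero => simp
  | succ t ih =>
    rw [Finset.sum_range_succ]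
    rcases Nat.eq_zero_or_pos t with rfl | ht
    · norm_num
    · have ht' : (1 : ℝ) ≤ t := by exact_mod_cast ht
      have : 1 / ((t + 1 : ℕ) : ℝ) ^ 3 ≤ 1 / (t : ℝ) - 1 / ((t + 1 : ℕ) : ℝ) := by
        push_cast
        rw [div_sub_div _ _ (by positivity) (by positivity),
          div_le_div_iff₀ (by positivity) (by positivity)]
        nlinarith [pow_pos (show (0 : ℝ) < t by linarith) 3,
          pow_pos (show (0 : ℝ) < t by linarith) 2]
      linarith

/-- The expected regret of the bandit phase. -/
theorem expectedRegret_bandit_le {T : ℕ} {δ : ℝ} {D : ℝ → ℝ} (hD0 : ∀ x, 0 ≤ D x)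
    (hD1 : ∀ x, D x ≤ 1) {s : SearchState} (ha0 : ∀ j ∈ s.live, 0 ≤ s.a j)
    (ha1 : ∀ j ∈ s.live, s.a j ≤ 1) {i : ℕ} (hi : i ∈ s.live) (r : ℝ) {t : ℕ} (ht : t ≤ T) :
    expectedRegret (AlgState.price T) (AlgState.next T δ) D r t
        (.bandit s (fun _ => 0) (fun _ => 0))
      ≤ t * (r - s.a i * D (s.a i)) + 5 * s.live.card
        + 8 * √(Real.log T) * √((s.live.card : ℝ) * T) := by
  have h := expectedRegret_bandit_le_potential (δ := δ) hD0 hD1 ha0 ha1 hi r t (fun _ => 0)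
    (fun _ => 0) (by simpa using ht)
  have hF : ∑ n ∈ Finset.Ico 0 t, ucbFailure s.live (fun j => s.a j * D (s.a j)) n (fun _ => 0)
      (fun _ => 0) ≤ 4 * s.live.card := by
    have e : ∀ n, ucbFailure s.live (fun j => s.a j * D (s.a j)) n (fun _ => 0) (fun _ => 0)
        = 2 * s.live.card * (1 / (n : ℝ) ^ 3) := by
      intro n
      -- At `n = 0` both sides vanish: there are no play counts in `Icc 1 0`, and `1 / 0 = 0`.
      rcases Nat.eq_zero_or_pos n with rfl | hn
      · simp [ucbFailure]
      · rw [ucbFailure_zero _ _ hn]; ring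
    simp only [e, ← Finset.mul_sum, Nat.Ico_zero_eq_range]
    have h1 : ∑ n ∈ Finset.range t, 1 / (n : ℝ) ^ 3 ≤ 2 := by
      have h2 := sum_inv_cube_le t
      rw [Finset.sum_range_succ] at h2
      have : (0 : ℝ) ≤ 1 / (t : ℝ) ^ 3 := by positivity
      have : (0 : ℝ) ≤ 1 / (t : ℝ) := by positivity
      linarith
    nlinarith [Nat.cast_nonneg (α := ℝ) s.live.card]
  simp only [Finset.sum_const_zero, zero_add, if_true, Nat.cast_zero, Real.sqrt_zero, sub_zero,
    Finset.sum_const, nsmul_eq_mul, mul_one] at h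
  have hs : √((s.live.card : ℝ) * t) ≤ √((s.live.card : ℝ) * T) :=
    Real.sqrt_le_sqrt (by gcongr)
  have := mul_le_mul_of_nonneg_left hs (show 0 ≤ 8 * √(Real.log T) by positivity)
  linarith

/-! ### The demand function -/

namespace Instance

variable {n : ℕ} (I : Instance n)

theorem v_pos' (i : Fin (n + 1)) : 0 < I.v i :=
  I.v_pos.trans_le (I.v_strictMono.monotone (Fin.zero_le i))

theorem v_le_vMax (i : Fin (n + 1)) : I.v i ≤ I.vMax :=
  I.v_strictMono.monotone (Fin.le_last i)

theorem v_le_one' (i : Fin (n + 1)) : I.v i ≤ 1 := (I.v_le_vMax i).trans I.v_le_one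

theorem demand_nonneg (x : ℝ) : 0 ≤ I.demand x :=
  Finset.sum_nonneg fun i _ => by split_ifs; exacts [(I.p_pos i).le, le_rfl]

theorem demand_antitone : Antitone I.demand := fun x y hxy =>
  Finset.sum_le_sum fun i _ => by
    have := I.p_pos i
    split_ifs with h1 h2
    · exact le_rfl
    · exact absurd (hxy.trans h1) h2
    · exact this.le
    · exact le_rfl

theorem demand_of_le {x : ℝ} (hx : x ≤ I.v 0) : I.demand x = 1 := by
  rw [demand, ← I.p_sum]
  exact Finset.sum_congr rfl fun i _ =>
    if_pos (hx.trans (I.v_strictMono.monotone (Fin.zero_le i)))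

theorem demand_le_one (x : ℝ) : I.demand x ≤ 1 := by
  rw [demand, ← I.p_sum]
  exact Finset.sum_le_sum fun i _ => by split_ifs; exacts [le_rfl, (I.p_pos i).le]

theorem p_le_demand {x : ℝ} {i : Fin (n + 1)} (hx : x ≤ I.v i) : I.p i ≤ I.demand x := by
  have := Finset.single_le_sum (f := fun i => if x ≤ I.v i then I.p i else 0)
    (fun i _ => by split_ifs; exacts [(I.p_pos i).le, le_rfl]) (Finset.mem_univ i)
  exact (if_pos hx).symm.le.trans this

theorem demand_add_p_le {x y : ℝ} {i : Fin (n + 1)} (hx : x ≤ I.v i) (hy : I.v i < y) :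
    I.demand y + I.p i ≤ I.demand x := by
  have h : ∑ j, (if j = i then I.p i else 0) = I.p i := by simp
  rw [demand, demand, ← h, ← Finset.sum_add_distrib]
  refine Finset.sum_le_sum fun j _ => ?_
  have := I.p_pos j
  by_cases hj : j = i
  · subst hj; simp [hx, not_le.2 hy]
  · by_cases h1 : y ≤ I.v j
    · have : x ≤ I.v j := hx.trans (hy.le.trans h1)
      simp [h1, this, hj]
    · simp only [h1, hj, if_false, add_zero]
      split_ifs <;> linarith

theorem demand_eq_zero_or (x : ℝ) :
    I.demand x = 0 ∨ ∃ i, x ≤ I.v i ∧ I.demand x = I.demand (I.v i) := by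
  classical
  by_cases h : ∃ i, x ≤ I.v i
  · right
    let s : Finset (Fin (n + 1)) := Finset.univ.filter fun i => x ≤ I.v i
    have hs : s.Nonempty := by obtain ⟨i, hi⟩ := h; exact ⟨i, by simpa [s] using hi⟩
    have hm : x ≤ I.v (s.min' hs) := by simpa [s] using s.min'_mem hs
    refine ⟨s.min' hs, hm, Finset.sum_congr rfl fun j _ => ?_⟩
    have : x ≤ I.v j ↔ I.v (s.min' hs) ≤ I.v j := by
      refine ⟨fun hj => I.v_strictMono.monotone (s.min'_le j (by simpa [s] using hj)),
        fun hj => hm.trans hj⟩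
    simp only [this]
  · left
    push Not at h
    exact Finset.sum_eq_zero fun i _ => if_neg (not_le.2 (h i))

/-- The demand, except that it counts as `0` at the price `1`. -/
def innerDemand (x : ℝ) : ℝ := if x < 1 then I.demand x else 0

theorem innerDemand_of_lt {x : ℝ} (hx : x < 1) : I.innerDemand x = I.demand x := if_pos hx

theorem innerDemand_of_le {x : ℝ} (hx : 1 ≤ x) : I.innerDemand x = 0 := if_neg (not_lt.2 hx)

theorem innerDemand_antitone : Antitone I.innerDemand := fun x y hxy => by
  unfold innerDemand
  split_ifs with h1 h2
  · exact I.demand_antitone hxy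
  · exact absurd (hxy.trans_lt h1) h2
  · exact I.demand_nonneg x
  · exact le_rfl

/-- Counting the demand at 1 as 0 covers the valuation 1: it is not below the endpoint `y = 1`, yet
the drop up to `y` still includes its probability. -/
theorem p_le_innerDemand_sub {x y : ℝ} {i : Fin (n + 1)} (hx1 : x < 1) (hx : x ≤ I.v i)
    (hy : I.v i < y ∨ y = 1) : I.p i ≤ I.innerDemand x - I.innerDemand y := by
  rw [I.innerDemand_of_lt hx1]
  by_cases hy1 : y < 1
  · rw [I.innerDemand_of_lt hy1]
    have := I.demand_add_p_le hx (hy.resolve_right hy1.ne)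
    linarith
  · rw [I.innerDemand_of_le (not_lt.1 hy1)]
    linarith [I.p_le_demand hx]

/-- The demand takes at most `n + 1` positive values. -/
theorem card_le_of_injOn_innerDemand {s : Finset ℕ} {a : ℕ → ℝ}
    (h : Set.InjOn (fun j => I.innerDemand (a j)) s) : s.card ≤ n + 2 := by
  classical
  let L : Finset ℝ := insert 0 (Finset.univ.image fun i => I.demand (I.v i))
  have hL : L.card ≤ n + 2 := (Finset.card_insert_le _ _).trans
    (Nat.succ_le_succ (Finset.card_image_le.trans (by simp)))
  refine (Finset.card_le_card_of_injOn _ (fun j _ => ?_) h).trans hL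
  simp only [L, innerDemand, Finset.coe_insert, Finset.coe_image, Finset.coe_univ,
    Set.image_univ, Set.mem_insert_iff, Set.mem_range]
  split_ifs
  · rcases I.demand_eq_zero_or (a j) with h | ⟨i, _, h⟩
    · exact Or.inl h
    · exact Or.inr ⟨i, h.symm⟩
  · exact Or.inl rfl

end Instance

/-! ### The search phase -/

namespace SearchState

theorem wide_subset (T : ℕ) (s : SearchState) : s.wide T ⊆ s.live := Finset.filter_subset _ _

theorem pick_mem_wide {T : ℕ} {s : SearchState} (h : (s.wide T).Nonempty) :
    s.pick T ∈ s.wide T := by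
  have := Nat.sInf_mem (s := (s.wide T : Set ℕ)) h
  exact_mod_cast this

theorem pick_mem {T : ℕ} {s : SearchState} (h : (s.wide T).Nonempty) : s.pick T ∈ s.live :=
  s.wide_subset T (pick_mem_wide h)

theorem one_lt_sqrt_mul_of_pick {T : ℕ} (hT : 0 < T) {s : SearchState} (h : (s.wide T).Nonempty) :
    1 < √T * (s.b (s.pick T) - s.a (s.pick T)) := by
  have h1 := (Finset.mem_filter.1 (pick_mem_wide h)).2
  have hT' : 0 < √(T : ℝ) := Real.sqrt_pos.2 (by exact_mod_cast hT)
  rw [Real.rpow_neg (Nat.cast_nonneg T), ← Real.sqrt_eq_rpow] at h1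
  have := mul_lt_mul_of_pos_left h1 hT'
  rwa [mul_inv_cancel₀ hT'.ne'] at this

theorem threshold_pos {T : ℕ} (hT : 0 < T) {s : SearchState} (hk : 1 ≤ s.k) :
    0 < s.threshold T := by
  have h1 : (0 : ℝ) < T := by exact_mod_cast hT
  have h2 : (0 : ℝ) < s.k := by exact_mod_cast hk
  unfold threshold; positivity

/-- Thresholds grow with `k`, so old estimates stay accurate enough after a split. -/
theorem threshold_le {T : ℕ} {s s' : SearchState} (h : s.k ≤ s'.k) :
    s.threshold T ≤ s'.threshold T := by
  unfold threshold
  gcongr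

/-- The four possible outcomes of a macrostep. -/
theorem update_cases (T : ℕ) (s : SearchState) (d : ℝ) {P : SearchState → Prop}
    (hup : ∀ D, D = Function.update s.D (s.mid T) d →
      D (s.a (s.pick T)) - D (s.mid T) < s.threshold T →
      s.threshold T ≤ D (s.mid T) - D (s.b (s.pick T)) →
      P { s with D := D, a := Function.update s.a (s.pick T) (s.mid T) })
    (hremove : ∀ D, D = Function.update s.D (s.mid T) d →
      D (s.a (s.pick T)) - D (s.mid T) < s.threshold T →
      ¬ s.threshold T ≤ D (s.mid T) - D (s.b (s.pick T)) →
      P { s with D := D, live := s.live.erase (s.pick T) })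
    (hsplit : ∀ D, D = Function.update s.D (s.mid T) d →
      s.threshold T ≤ D (s.a (s.pick T)) - D (s.mid T) →
      (∀ j ≤ s.k, s.mid T < s.a j → s.threshold T ≤ D (s.mid T) - D (s.a j)) →
      P { k := s.k + 1
          live := insert (s.k + 1) s.live
          a := Function.update s.a (s.k + 1) (s.mid T)
          b := Function.update (Function.update s.b (s.k + 1) (s.b (s.pick T)))
            (s.pick T) (s.mid T)
          D := D })
    (hdown : ∀ D, D = Function.update s.D (s.mid T) d →
      s.threshold T ≤ D (s.a (s.pick T)) - D (s.mid T) →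
      (¬ ∀ j ≤ s.k, s.mid T < s.a j → s.threshold T ≤ D (s.mid T) - D (s.a j)) →
      P { s with D := D, b := Function.update s.b (s.pick T) (s.mid T) }) :
    P (s.update T d) := by
  unfold SearchState.update
  simp only [Finset.mem_range, Nat.lt_succ_iff]
  split_ifs with h1 h2 h2
  · exact hup _ rfl h1 h2
  · exact hremove _ rfl h1 h2
  · exact hsplit _ rfl (not_lt.1 h1) h2
  · exact hdown _ rfl (not_lt.1 h1) h2

/-- The prices stored in a state are nonnegative. -/
def Nonneg (s : SearchState) : Prop := ∀ j, 0 ≤ s.a j ∧ 0 ≤ s.b j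

theorem Nonneg.init : SearchState.init.Nonneg := fun j => by
  constructor
  · by_cases hj : j = 0 <;> simp [SearchState.init, hj]
  · simp [SearchState.init]

theorem Nonneg.mid {s : SearchState} (h : s.Nonneg) (T : ℕ) : 0 ≤ s.mid T := by
  have := h (s.pick T)
  unfold SearchState.mid
  linarith [this.1, this.2]

theorem Nonneg.update {s : SearchState} (h : s.Nonneg) (T : ℕ) (d : ℝ) :
    (s.update T d).Nonneg := by
  have hm := h.mid T
  refine update_cases T s d ?_ ?_ ?_ ?_ <;> intro D _ _ _ j <;> dsimp only <;>
    (try simp only [Function.update_apply]) <;> constructor <;> (try split_ifs) <;>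
    first | exact hm | exact (h _).1 | exact (h _).2

/-- What holds during the search phase as long as all estimates are accurate: the prices `a j` are
separated by valuations, and the valuation number `o` lies in an interval that is alive. -/
structure Invariant {n : ℕ} (I : Instance n) (T : ℕ) (o : Fin (n + 1)) (s : SearchState) :
    Prop where
  k_pos : 1 ≤ s.k
  one_le : ∀ j ∈ s.live, 1 ≤ j
  le_k : ∀ j ∈ s.live, j ≤ s.k
  a_zero : s.a 0 = 1
  a_nonneg : ∀ j, 0 ≤ s.a j
  b_le_one : ∀ j ∈ s.live, s.b j ≤ 1
  disjoint : ∀ i ∈ s.live, ∀ j ≤ s.k, s.a i < s.a j → s.b i ≤ s.a j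
  injective : ∀ i ≤ s.k, ∀ j ≤ s.k, i ≠ j → I.innerDemand (s.a i) ≠ I.innerDemand (s.a j)
  estimate_a : ∀ j ≤ s.k, |s.D (s.a j) - I.innerDemand (s.a j)| < s.threshold T / 2
  estimate_b : ∀ j ∈ s.live, |s.D (s.b j) - I.innerDemand (s.b j)| < s.threshold T / 2
  target : ∃ j ∈ s.live, s.a j ≤ I.v o ∧ (I.v o < s.b j ∨ s.b j = 1)
  width : ∀ j ∈ s.live, 1 ≤ 2 * √T * (s.b j - s.a j)

theorem Invariant.init {n : ℕ} (I : Instance n) {T : ℕ} (hT : 2 ≤ T) (o : Fin (n + 1)) :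
    Invariant I T o SearchState.init := by
  have h0 : I.innerDemand 0 = 1 := by
    rw [I.innerDemand_of_lt one_pos, I.demand_of_le I.v_pos.le]
  have h1 : I.innerDemand 1 = 0 := I.innerDemand_of_le le_rfl
  have ht := threshold_pos (s := SearchState.init) (T := T) (by omega) le_rfl
  have hT1 : 1 ≤ √(T : ℝ) := Real.one_le_sqrt.2 (by exact_mod_cast (by omega : 1 ≤ T))
  have ha : ∀ j, SearchState.init.a j = 1 ∧ j = 0 ∨ SearchState.init.a j = 0 ∧ j ≠ 0 := fun j => by
    by_cases h : j = 0 <;> simp [SearchState.init, h]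
  refine ⟨le_rfl, ?_, ?_, rfl, ?_, ?_, ?_, ?_, ?_, ?_, ?_, ?_⟩
  · simp [SearchState.init]
  · simp [SearchState.init]
  · intro j; rcases ha j with h | h <;> rw [h.1]; exact zero_le_one
  · simp [SearchState.init]
  · intro i _ j _ hij
    rcases ha j with h | h
    · rw [h.1]; exact le_rfl
    · rcases ha i with h' | h' <;> rw [h.1, h'.1] at hij <;> norm_num at hij
  · intro i hi j hj hij
    have hi : i ≤ 1 := hi
    have hj : j ≤ 1 := hj
    rcases ha j with h | h <;> rcases ha i with h' | h' <;> rw [h.1, h'.1] <;>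
      first | (exfalso; omega) | (rw [h0, h1]; norm_num)
  · intro j _
    rcases ha j with h | h <;> rw [h.1]
    · rw [h1]; simpa [SearchState.init] using ht
    · rw [h0]; simpa [SearchState.init] using ht
  · intro j _
    change |SearchState.init.D 1 - I.innerDemand 1| < _
    rw [h1]; simpa [SearchState.init] using ht
  · exact ⟨1, by simp [SearchState.init], by simpa [SearchState.init] using (I.v_pos' o).le,
      Or.inr rfl⟩
  · intro j hj
    obtain rfl : j = 1 := by simpa [SearchState.init] using hj
    simp [SearchState.init]
    linarith

/-- The `k + 1` points, sentinel included, have distinct demands, and at most `n + 2` values are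
possible, counting 0. -/
theorem Invariant.k_le {n : ℕ} {I : Instance n} {T : ℕ} {o : Fin (n + 1)} {s : SearchState}
    (h : Invariant I T o s) : s.k ≤ n + 1 := by
  have := I.card_le_of_injOn_innerDemand (s := Finset.range (s.k + 1)) (a := s.a) ?_
  · simpa using this
  · intro i hi j hj hij
    by_contra hne
    simp only [Finset.coe_range, Set.mem_Iio, Nat.lt_succ_iff] at hi hj
    exact h.injective i hi j hj hne hij

theorem Invariant.card_live_le {n : ℕ} {I : Instance n} {T : ℕ} {o : Fin (n + 1)}
    {s : SearchState} (h : Invariant I T o s) : s.live.card ≤ n + 1 := by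
  have : s.live ⊆ Finset.Icc 1 s.k := fun j hj =>
    Finset.mem_Icc.2 ⟨h.one_le j hj, h.le_k j hj⟩
  have := Finset.card_le_card this
  rw [Nat.card_Icc] at this
  have := h.k_le
  omega

/-- With errors below `θ / 2`, an observed drop of `θ` cannot be pure noise; conversely
(`le_of_estimates`) a true drop of `2 θ` is observed as at least `θ`. -/
theorem lt_of_estimates {A B α β θ : ℝ} (hA : |A - α| < θ / 2) (hB : |B - β| < θ / 2)
    (h : θ ≤ A - B) : β < α := by
  rw [abs_lt] at hA hB
  linarith [hA.1, hA.2, hB.1, hB.2]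

theorem le_of_estimates {A B α β θ : ℝ} (hA : |A - α| < θ / 2) (hB : |B - β| < θ / 2)
    (h : 2 * θ ≤ α - β) : θ ≤ A - B := by
  rw [abs_lt] at hA hB
  linarith [hA.1, hA.2, hB.1, hB.2]

/-- An accurate estimate preserves the invariant. -/
theorem Invariant.update {n : ℕ} {I : Instance n} {T : ℕ} {o : Fin (n + 1)} {s : SearchState}
    (h : Invariant I T o s) (hT : 0 < T) (hp : (((n : ℝ) + 1) / T) ^ (1 / 4 : ℝ) ≤ I.p o)
    (hw : (s.wide T).Nonempty) {d : ℝ} (hd : |d - I.innerDemand (s.mid T)| < s.threshold T / 2) :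
    Invariant I T o (s.update T d) := by
  -- Here `2 θ = (k / T) ^ (1/4)` and `k ≤ n + 1`.
  have hpθ : 2 * s.threshold T ≤ I.p o := by
    refine le_trans ?_ hp
    have : ((s.k : ℕ) : ℝ) ≤ (n : ℝ) + 1 := by exact_mod_cast h.k_le
    rw [SearchState.threshold, mul_div_cancel₀ _ (by norm_num)]
    gcongr
  have hTr : 0 < √(T : ℝ) := Real.sqrt_pos.2 (by exact_mod_cast hT)
  have hwide := one_lt_sqrt_mul_of_pick hT hw
  have hi := pick_mem hw
  have hx : s.mid T = (s.a (s.pick T) + s.b (s.pick T)) / 2 := rfl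
  generalize hxe : s.mid T = x at hx hd
  set i := s.pick T with hi_def
  have hb1 := h.b_le_one i hi
  have hik := h.le_k i hi
  have hi1 := h.one_le i hi
  have hi0 : (0 : ℕ) ≠ i := by omega
  have hab : s.a i < s.b i := by
    by_contra hc
    linarith [mul_nonpos_of_nonneg_of_nonpos hTr.le (sub_nonpos.2 (not_lt.1 hc))]
  have hax : s.a i < x := by linarith
  have hxb : x < s.b i := by linarith
  have hw1 : 1 ≤ 2 * √T * (x - s.a i) := by rw [hx]; linarith
  have hw2 : 1 ≤ 2 * √T * (s.b i - x) := by rw [hx]; linarith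
  have hx0 : 0 ≤ x := (h.a_nonneg i).trans hax.le
  have hsep : ∀ j ≤ s.k, j ≠ i →
      (s.a j < s.a i ∧ I.innerDemand (s.a i) < I.innerDemand (s.a j)) ∨ s.b i ≤ s.a j := by
    intro j hj hji
    have hne := h.injective j hj i hik hji
    rcases lt_trichotomy (s.a j) (s.a i) with hlt | heq | hgt
    · exact Or.inl ⟨hlt, lt_of_le_of_ne (I.innerDemand_antitone hlt.le) hne.symm⟩
    · exact absurd (congrArg _ heq) hne
    · exact Or.inr (h.disjoint i hi j hj hgt)
  have hleft : ∀ j ∈ s.live, j ≠ i → s.a j < x → s.b j ≤ s.a i := by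
    intro j hj hji hjx
    rcases hsep j (h.le_k j hj) hji with hlt | hle
    · exact h.disjoint j hj i hik hlt.1
    · linarith
  -- Should `x` coincide with a stored price, the overwritten estimate is accurate as well.
  have hest : ∀ D, D = Function.update s.D x d → |D x - I.innerDemand x| < s.threshold T / 2 ∧
      ∀ y, |s.D y - I.innerDemand y| < s.threshold T / 2 →
        |D y - I.innerDemand y| < s.threshold T / 2 := by
    rintro D rfl
    refine ⟨by simpa using hd, fun y hy => ?_⟩
    by_cases hyx : y = x
    · subst hyx; simpa using hd
    · rwa [Function.update_of_ne hyx]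
  -- If `v o` lies in the lower half, the drop across that half is observed.
  have hlow : ∀ D, D = Function.update s.D x d → s.a i ≤ I.v o → I.v o < x →
      s.threshold T ≤ D (s.a i) - D x := by
    intro D hD ha hv
    have := I.p_le_innerDemand_sub (hax.trans (hxb.trans_le hb1)) ha (Or.inl hv)
    exact le_of_estimates ((hest D hD).2 _ (h.estimate_a i hik)) (hest D hD).1 (by linarith)
  -- If `v o` lies in the upper half, the drop from `x` to any stored point at or beyond `b i` is
  -- observed.
  have hhigh : ∀ D, D = Function.update s.D x d → x ≤ I.v o → (I.v o < s.b i ∨ s.b i = 1) →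
      ∀ y, s.b i ≤ y → |s.D y - I.innerDemand y| < s.threshold T / 2 →
      s.threshold T ≤ D x - D y := by
    intro D hD ha hv y hy hyD
    have h1 := I.p_le_innerDemand_sub (hxb.trans_le hb1) ha hv
    have h2 := I.innerDemand_antitone hy
    exact le_of_estimates (hest D hD).1 ((hest D hD).2 _ hyD) (by linarith)
  obtain ⟨t, ht, hta, htb⟩ := h.target
  refine update_cases T s d ?_ ?_ ?_ ?_ <;> rw [hxe, ← hi_def] <;> intro D hD h1 h2
  · have hlt := lt_of_estimates (hest D hD).1 ((hest D hD).2 _ (h.estimate_b i hi)) h2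
    have hnew : ∀ j ≤ s.k, j ≠ i → I.innerDemand x ≠ I.innerDemand (s.a j) := by
      intro j hj hji
      rcases hsep j hj hji with hl | hl
      · exact ((I.innerDemand_antitone hax.le).trans_lt hl.2).ne
      · exact ((I.innerDemand_antitone hl).trans_lt hlt).ne'
    refine ⟨h.k_pos, h.one_le, h.le_k, ?_, ?_, h.b_le_one, ?_, ?_, ?_, ?_, ?_, ?_⟩
    · simpa [hi0] using h.a_zero
    · intro j
      dsimp only
      rw [Function.update_apply]
      split_ifs
      exacts [hx0, h.a_nonneg j]
    · intro j hj l hl hjl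
      dsimp only at hj hl hjl ⊢
      rw [Function.update_apply, Function.update_apply] at hjl
      rw [Function.update_apply]
      by_cases hji : j = i <;> by_cases hli : l = i <;>
        simp only [hji, hli, if_true, if_false] at hjl ⊢
      · exact absurd hjl (lt_irrefl _)
      · exact h.disjoint i hi l hl (hax.trans hjl)
      · exact (hleft j hj hji hjl).trans hax.le
      · exact h.disjoint j hj l hl hjl
    · intro j hj l hl hjl
      dsimp only at hj hl ⊢
      rw [Function.update_apply, Function.update_apply]
      split_ifs with hji hli hli
      · omega
      · exact hnew l hl hli
      · exact (hnew j hj hji).symm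
      · exact h.injective j hj l hl hjl
    · intro j hj
      dsimp only at hj ⊢
      rw [Function.update_apply]
      split_ifs
      exacts [(hest D hD).1, (hest D hD).2 _ (h.estimate_a j hj)]
    · exact fun j hj => (hest D hD).2 _ (h.estimate_b j hj)
    · refine ⟨t, ht, ?_, htb⟩
      dsimp only
      rw [Function.update_apply]
      split_ifs with hti
      · by_contra hc
        rw [hti] at hta
        linarith [hlow D hD hta (not_le.1 hc)]
      · exact hta
    · intro j hj
      dsimp only
      rw [Function.update_apply]
      split_ifs with hji
      · rwa [hji]
      · exact h.width j hj
  · have hsub : ∀ j ∈ s.live.erase i, j ∈ s.live := fun j hj => Finset.mem_of_mem_erase hj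
    refine ⟨h.k_pos, fun j hj => h.one_le j (hsub j hj), fun j hj => h.le_k j (hsub j hj),
      h.a_zero, h.a_nonneg, fun j hj => h.b_le_one j (hsub j hj),
      fun j hj => h.disjoint j (hsub j hj), h.injective,
      fun j hj => (hest D hD).2 _ (h.estimate_a j hj),
      fun j hj => (hest D hD).2 _ (h.estimate_b j (hsub j hj)), ?_,
      fun j hj => h.width j (hsub j hj)⟩
    -- The interval around `v o` is not the removed one: whichever half contains `v o` would have
    -- shown a drop.
    refine ⟨t, Finset.mem_erase.2 ⟨?_, ht⟩, hta, htb⟩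
    rintro rfl
    rcases lt_or_ge (I.v o) x with hv | hv
    · linarith [hlow D hD hta hv]
    · exact h2 (hhigh D hD hv htb _ le_rfl (h.estimate_b _ ht))
  · have hki : i ≠ s.k + 1 := by omega
    have hlt := lt_of_estimates ((hest D hD).2 _ (h.estimate_a i hik)) (hest D hD).1 h1
    have hkl : s.k + 1 ∉ s.live := fun hc => by have := h.le_k _ hc; omega
    have hne : ∀ j ≤ s.k, j ≠ s.k + 1 := fun j hj => by omega
    have hnl : ∀ j ∈ s.live, j ≠ s.k + 1 := fun j hj => hne j (h.le_k j hj)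
    have hdn : ∀ j, j ≤ s.k + 1 → j ≠ s.k + 1 → j ≤ s.k := fun j h1 h2 => by omega
    have hnew : ∀ j ≤ s.k, I.innerDemand x ≠ I.innerDemand (s.a j) := by
      intro j hj
      by_cases hji : j = i
      · rw [hji]; exact hlt.ne
      rcases hsep j hj hji with hl | hl
      · exact (hlt.trans hl.2).ne
      · exact (lt_of_estimates (hest D hD).1 ((hest D hD).2 _ (h.estimate_a j hj))
          (h2 j hj (hxb.trans_le hl))).ne'
    refine ⟨?_, ?_, ?_, ?_, ?_, ?_, ?_, ?_, ?_, ?_, ?_, ?_⟩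
    · exact Nat.le_add_left 1 s.k
    · intro j hj
      rcases Finset.mem_insert.1 hj with rfl | hj
      exacts [Nat.le_add_left 1 s.k, h.one_le j hj]
    · intro j hj
      rcases Finset.mem_insert.1 hj with rfl | hj
      exacts [le_rfl, (h.le_k j hj).trans (Nat.le_succ _)]
    · simpa using h.a_zero
    · intro j
      dsimp only
      rw [Function.update_apply]
      split_ifs
      exacts [hx0, h.a_nonneg j]
    · intro j hj
      dsimp only
      rw [Function.update_apply, Function.update_apply]
      rcases Finset.mem_insert.1 hj with rfl | hj
      · simpa [hki.symm] using hb1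
      · split_ifs
        exacts [hxb.le.trans hb1, hb1, h.b_le_one j hj]
    · intro j hj l hl hjl
      dsimp only at hjl ⊢
      rw [Function.update_apply, Function.update_apply] at hjl
      rw [Function.update_apply, Function.update_apply, Function.update_apply]
      rcases Finset.mem_insert.1 hj with rfl | hj
      · simp only [if_true] at hjl
        by_cases hl' : l = s.k + 1
        · simp [hl'] at hjl
        · simp only [hl', if_false, hki.symm, if_true] at hjl ⊢
          exact h.disjoint i hi l (hdn _ hl hl') (hax.trans hjl)
      · simp only [hnl j hj, if_false] at hjl ⊢
        by_cases hl' : l = s.k + 1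
        · simp only [hl', if_true] at hjl ⊢
          split_ifs with hji
          · exact le_rfl
          · exact (hleft j hj hji hjl).trans hax.le
        · simp only [hl', if_false] at hjl ⊢
          have := h.disjoint j hj l (hdn _ hl hl') hjl
          split_ifs with hji
          · rw [hji] at this
            exact hxb.le.trans this
          · exact this
    · intro j hj l hl hjl
      dsimp only at hj hl ⊢
      rw [Function.update_apply, Function.update_apply]
      by_cases hj' : j = s.k + 1 <;> by_cases hl' : l = s.k + 1 <;>
        simp only [hj', hl', if_true, if_false]
      · omega
      · exact hnew l (hdn _ hl hl')
      · exact (hnew j (hdn _ hj hj')).symm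
      · exact h.injective j (hdn _ hj hj') l
          (hdn _ hl hl') hjl
    · intro j hj
      -- The new state has one more interval and hence a larger threshold, so accuracy for the old
      -- one suffices.
      refine lt_of_lt_of_le ?_ (div_le_div_of_nonneg_right
        (threshold_le (T := T) (s := s) (Nat.le_succ s.k)) zero_le_two)
      dsimp only at hj ⊢
      rw [Function.update_apply]
      split_ifs with hj'
      exacts [(hest D hD).1, (hest D hD).2 _ (h.estimate_a j (hdn _ hj hj'))]
    · intro j hj
      refine lt_of_lt_of_le ?_ (div_le_div_of_nonneg_right
        (threshold_le (T := T) (s := s) (Nat.le_succ s.k)) zero_le_two)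
      dsimp only
      rw [Function.update_apply, Function.update_apply]
      rcases Finset.mem_insert.1 hj with rfl | hj
      · simpa [hki.symm] using (hest D hD).2 _ (h.estimate_b i hi)
      · split_ifs
        exacts [(hest D hD).1, (hest D hD).2 _ (h.estimate_b i hi),
          (hest D hD).2 _ (h.estimate_b j hj)]
    · by_cases hti : t = i
      · rw [hti] at hta htb
        rcases lt_or_ge (I.v o) x with hv | hv
        · exact ⟨i, Finset.mem_insert_of_mem hi, by simpa [hki] using hta,
            Or.inl (by simpa using hv)⟩
        · exact ⟨s.k + 1, Finset.mem_insert_self _ _, by simpa using hv,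
            by simpa [hki.symm] using htb⟩
      · exact ⟨t, Finset.mem_insert_of_mem ht, by simpa [hnl t ht] using hta,
          by simpa [hnl t ht, hti] using htb⟩
    · intro j hj
      dsimp only
      rw [Function.update_apply, Function.update_apply, Function.update_apply]
      rcases Finset.mem_insert.1 hj with rfl | hj
      · simpa [hki.symm] using hw2
      · simp only [hnl j hj, if_false]
        split_ifs with hji
        · rwa [hji]
        · exact h.width j hj
  · refine ⟨h.k_pos, h.one_le, h.le_k, h.a_zero, h.a_nonneg, ?_, ?_, h.injective,
      fun j hj => (hest D hD).2 _ (h.estimate_a j hj), ?_, ?_, ?_⟩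
    · intro j hj
      dsimp only
      rw [Function.update_apply]
      split_ifs
      exacts [hxb.le.trans hb1, h.b_le_one j hj]
    · intro j hj l hl hjl
      dsimp only
      rw [Function.update_apply]
      have := h.disjoint j hj l hl hjl
      split_ifs with hji
      · rw [hji] at this
        exact hxb.le.trans this
      · exact this
    · intro j hj
      dsimp only
      rw [Function.update_apply]
      split_ifs
      exacts [(hest D hD).1, (hest D hD).2 _ (h.estimate_b j hj)]
    · refine ⟨t, ht, hta, ?_⟩
      dsimp only
      rw [Function.update_apply]
      split_ifs with hti
      · rw [hti] at htb
        left
        by_contra hc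
        -- Were `v o` in the discarded upper half, the test against every stored point to the right
        -- would have succeeded and caused a split.
        refine h2 fun j hj hxj => hhigh D hD (not_lt.1 hc) htb _ ?_ (h.estimate_a j hj)
        exact h.disjoint i hi j hj (hax.trans hxj)
      · exact htb
    · intro j hj
      dsimp only
      rw [Function.update_apply]
      split_ifs with hji
      · rwa [hji]
      · exact h.width j hj

/-! ### Total cost of the macrosteps -/

/-- The number of times that an interval of length `w` can still be halved. -/
def halvings (T : ℕ) (w : ℝ) : ℝ := Real.logb 2 (2 * √T * w)

/-- An upper bound for the total cost of the remaining macrosteps, when a macrostep with `j`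
allocated intervals costs `c j` and there can be at most `m` intervals. -/
def searchCost (T m : ℕ) (c : ℕ → ℝ) (s : SearchState) : ℝ :=
  ∑ j ∈ s.live, halvings T (s.b j - s.a j) * c j + ∑ j ∈ Finset.Ioc s.k m, halvings T 1 * c j

theorem halvings_half {T : ℕ} (hT : 0 < T) {w : ℝ} (hw : 0 < w) :
    halvings T (w / 2) = halvings T w - 1 := by
  have hT' : 0 < √(T : ℝ) := Real.sqrt_pos.2 (by exact_mod_cast hT)
  rw [halvings, halvings, ← mul_div_assoc, Real.logb_div (by positivity) (by norm_num),
    Real.logb_self_eq_one (by norm_num)]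

theorem halvings_nonneg {T : ℕ} {w : ℝ} (h : 1 ≤ 2 * √T * w) : 0 ≤ halvings T w :=
  Real.logb_nonneg (by norm_num) h

theorem halvings_mono {T : ℕ} (hT : 0 < T) {w w' : ℝ} (hw : 0 < w) (h : w ≤ w') :
    halvings T w ≤ halvings T w' := by
  have hT' : 0 < √(T : ℝ) := Real.sqrt_pos.2 (by exact_mod_cast hT)
  exact Real.logb_le_logb_of_le (by norm_num) (by positivity) (by gcongr)

theorem Invariant.searchCost_nonneg {n : ℕ} {I : Instance n} {T : ℕ} {o : Fin (n + 1)}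
    {s : SearchState} (h : Invariant I T o s) (hT : 0 < T) {c : ℕ → ℝ} (hc : ∀ j, 0 ≤ c j)
    (m : ℕ) : 0 ≤ s.searchCost T m c := by
  have h1 : 1 ≤ √(T : ℝ) := Real.one_le_sqrt.2 (by exact_mod_cast hT)
  exact add_nonneg
    (Finset.sum_nonneg fun j hj => mul_nonneg (halvings_nonneg (h.width j hj)) (hc j))
    (Finset.sum_nonneg fun j _ => mul_nonneg (halvings_nonneg (by linarith)) (hc j))

/-- Each macrostep reduces the remaining cost by its own cost. -/
theorem Invariant.searchCost_update {n : ℕ} {I : Instance n} {T : ℕ} {o : Fin (n + 1)}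
    {s : SearchState} (h : Invariant I T o s) (hT : 0 < T) (hw : (s.wide T).Nonempty) {d : ℝ}
    (h' : Invariant I T o (s.update T d)) {c : ℕ → ℝ} (hc : ∀ j, 0 ≤ c j)
    (hanti : ∀ i j, 1 ≤ i → i ≤ j → c j ≤ c i) :
    (s.update T d).searchCost T (n + 1) c + c s.k ≤ s.searchCost T (n + 1) c := by
  have hTr : 0 < √(T : ℝ) := Real.sqrt_pos.2 (by exact_mod_cast hT)
  have hwide := one_lt_sqrt_mul_of_pick hT hw
  have hi := pick_mem hw
  have hx : s.mid T = (s.a (s.pick T) + s.b (s.pick T)) / 2 := rfl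
  generalize hxe : s.mid T = x at hx
  -- Reverted so that it follows the case distinction: after a split it says that the index `k + 1`
  -- was still in reserve.
  have hk' := h'.k_le
  revert hk'
  set i := s.pick T with hi_def
  have hik := h.le_k i hi
  -- The halving is credited at rate `c i`, which covers the actual cost `c k`.
  have hci := hanti i s.k (h.one_le i hi) hik
  have hab : s.a i < s.b i := by
    by_contra hc
    linarith [mul_nonpos_of_nonneg_of_nonpos hTr.le (sub_nonpos.2 (not_lt.1 hc))]
  have hhalf := halvings_half hT (sub_pos.2 hab)
  have hw1 : x - s.a i = (s.b i - s.a i) / 2 := by rw [hx]; ring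
  have hw2 : s.b i - x = (s.b i - s.a i) / 2 := by rw [hx]; ring
  have hhalf0 : 0 ≤ halvings T ((s.b i - s.a i) / 2) := halvings_nonneg (by linarith)
  refine update_cases (P := fun s' => s'.k ≤ n + 1 →
    s'.searchCost T (n + 1) c + c s.k ≤ s.searchCost T (n + 1) c) T s d ?_ ?_ ?_ ?_ <;>
    rw [hxe, ← hi_def] <;> intro D hD h1 h2 hk' <;>
    simp only [searchCost]
  · rw [sum_eq_add_sub_of_eq_off (F := fun j => halvings T (s.b j - s.a j) * c j) hi
      (fun j _ hj => by rw [Function.update_of_ne hj]), Function.update_self, hw2, hhalf]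
    linarith
  · rw [← Finset.add_sum_erase _ _ hi]
    -- A removed interval was wide, so it still had a credit of at least one halving.
    have hm := mul_nonneg hhalf0 (hc i)
    rw [hhalf] at hm
    linarith
  · have hki : i ≠ s.k + 1 := by omega
    have hkl : s.k + 1 ∉ s.live := fun hc => by have := h.le_k _ hc; omega
    have hnl : ∀ j ∈ s.live, j ≠ s.k + 1 := fun j hj hc => hkl (hc ▸ hj)
    rw [Finset.sum_insert hkl,
      sum_eq_add_sub_of_eq_off (F := fun j => halvings T (s.b j - s.a j) * c j) hi
        (fun j hj hji => by
          rw [Function.update_of_ne hji, Function.update_of_ne (hnl j hj),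
            Function.update_of_ne (hnl j hj)]),
      Function.update_self, Function.update_of_ne hki.symm, Function.update_self,
      Function.update_self, Function.update_of_ne hki, hw1, hw2]
    -- The new interval draws on the credit reserved for index `k + 1`, which suffices for length 1.
    have hIoc : ∑ j ∈ Finset.Ioc s.k (n + 1), halvings T 1 * c j = halvings T 1 * c (s.k + 1)
        + ∑ j ∈ Finset.Ioc (s.k + 1) (n + 1), halvings T 1 * c j := by
      rw [← Finset.insert_Ioc_add_one_left_eq_Ioc (by exact hk'), Finset.sum_insert (by simp)]
    have hle : halvings T ((s.b i - s.a i) / 2) ≤ halvings T 1 :=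
      halvings_mono hT (by linarith) (by linarith [h.b_le_one i hi, h.a_nonneg i])
    have := mul_le_mul_of_nonneg_right hle (hc (s.k + 1))
    rw [hIoc]
    rw [hhalf] at *
    linarith
  · rw [sum_eq_add_sub_of_eq_off (F := fun j => halvings T (s.b j - s.a j) * c j) hi
      (fun j _ hj => by rw [Function.update_of_ne hj]), Function.update_self, hw1, hhalf]
    linarith

end SearchState

/-! ### The regret of the search phase -/

/-- The search state that is stored in a state of the algorithm. -/
def AlgState.searchState : AlgState → SearchState
  | .search s _ _ => s
  | .bandit s _ _ => s

theorem AlgState.searchState_enter (T : ℕ) (s : SearchState) :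
    (AlgState.enter T s).searchState = s := by
  unfold AlgState.enter
  split_ifs <;> rfl

theorem AlgState.price_nonneg (T : ℕ) {q : AlgState} (h : q.searchState.Nonneg) :
    0 ≤ q.price T := by
  cases q with
  | search s o c => exact h.mid T
  | bandit s N G =>
    simp only [AlgState.price]
    split_ifs
    exacts [le_rfl, (h _).1]

theorem AlgState.nonneg_next (T : ℕ) (δ : ℝ) {q : AlgState} (h : q.searchState.Nonneg)
    (sold : Bool) : (q.next T δ sold).searchState.Nonneg := by
  cases q with
  | search s o c =>
    simp only [AlgState.next]
    by_cases hm : s.macroLength T δ ≤ o + 1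
    · rw [if_pos hm, AlgState.searchState_enter]
      exact SearchState.Nonneg.update h T _
    · rw [if_neg hm]
      exact h
  | bandit s N G => exact h

/-- Nonnegative prices earn at least 0 per round. Unlike `Invariant`, nonnegativity survives
inaccurate estimates, so this bound is available after a failure. -/
theorem expectedRegret_le_horizon {T : ℕ} {δ : ℝ} {D : ℝ → ℝ} (hD0 : ∀ x, 0 ≤ D x)
    (hD1 : ∀ x, D x ≤ 1) {r : ℝ} (hr : r ≤ 1) (t : ℕ) {q : AlgState} (h : q.searchState.Nonneg) :
    expectedRegret (AlgState.price T) (AlgState.next T δ) D r t q ≤ t := by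
  induction t generalizing q with
  | zero => simp [expectedRegret]
  | succ t ih =>
    simp only [expectedRegret]
    have h1 := mul_le_mul_of_nonneg_left (ih (q.nonneg_next T δ h true)) (hD0 (q.price T))
    have h2 := mul_le_mul_of_nonneg_left (ih (q.nonneg_next T δ h false))
      (sub_nonneg.2 (hD1 (q.price T)))
    have h3 := mul_nonneg (q.price_nonneg T h) (hD0 (q.price T))
    push_cast
    linarith

namespace SearchState

/-- At offered prices `innerDemand` is thus the true demand, the quantity that is sampled. -/
theorem Invariant.mid_lt_one {n : ℕ} {I : Instance n} {T : ℕ} {o : Fin (n + 1)} {s : SearchState}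
    (h : Invariant I T o s) (hT : 0 < T) (hw : (s.wide T).Nonempty) : s.mid T < 1 := by
  have hTr : 0 < √(T : ℝ) := Real.sqrt_pos.2 (by exact_mod_cast hT)
  have hwide := one_lt_sqrt_mul_of_pick hT hw
  have hb := h.b_le_one _ (pick_mem hw)
  have hab : s.a (s.pick T) < s.b (s.pick T) := by
    by_contra hc
    linarith [mul_nonpos_of_nonneg_of_nonpos hTr.le (sub_nonpos.2 (not_lt.1 hc))]
  unfold SearchState.mid
  linarith

theorem sq_threshold {T : ℕ} (s : SearchState) : s.threshold T ^ 2 = √((s.k : ℝ) / T) / 4 := by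
  rw [threshold, div_pow, ← Real.rpow_natCast, ← Real.rpow_mul (by positivity), Real.sqrt_eq_rpow]
  norm_num

theorem macroLength_pos {T : ℕ} (hT : 2 ≤ T) {s : SearchState} (hk : 1 ≤ s.k) :
    0 < s.macroLength T ((T : ℝ) ^ 2)⁻¹ := by
  have h1 : (0 : ℝ) < T := by exact_mod_cast (by omega : 0 < T)
  have h2 : (0 : ℝ) < s.k := by exact_mod_cast hk
  have h3 : 0 < Real.log ((T : ℝ) ^ 2) := Real.log_pos (by
    have : (2 : ℝ) ≤ T := by exact_mod_cast hT
    nlinarith)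
  unfold macroLength
  rw [Nat.ceil_pos, inv_inv]
  positivity

/-- A macrostep is long enough for an accurate estimate with high probability. -/
theorem mul_deviationBound_le_one {T : ℕ} (hT : 2 ≤ T) {s : SearchState} (hk : 1 ≤ s.k) (q : ℝ) :
    T * deviationBound (s.macroLength T ((T : ℝ) ^ 2)⁻¹) q (s.threshold T / 2) 0 0 ≤ 1 := by
  have h1 : (0 : ℝ) < T := by exact_mod_cast (by omega : 0 < T)
  have h2 : (0 : ℝ) < s.k := by exact_mod_cast hk
  have h2T : (2 : ℝ) ≤ T := by exact_mod_cast hT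
  have hm : 8 * √((T : ℝ) / s.k) * Real.log ((T : ℝ) ^ 2) ≤ s.macroLength T ((T : ℝ) ^ 2)⁻¹ := by
    unfold macroLength
    rw [inv_inv]
    exact Nat.le_ceil _
  have hs : √((s.k : ℝ) / T) * √((T : ℝ) / s.k) = 1 := by
    rw [← Real.sqrt_mul (by positivity), div_mul_div_comm, mul_comm (T : ℝ),
      div_self (by positivity), Real.sqrt_one]
  -- Since `θ ^ 2 = √(k / T) / 4`, the exponent is `√(k / T) / 8` times the length, and the factor 8
  -- in the length cancels. The tail is then `2 * T ^ (-2)`.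
  have he : Real.log ((T : ℝ) ^ 2)
      ≤ 2 * (s.threshold T / 2) ^ 2 * s.macroLength T ((T : ℝ) ^ 2)⁻¹ := by
    have := mul_le_mul_of_nonneg_left hm (Real.sqrt_nonneg ((s.k : ℝ) / T))
    rw [div_pow, sq_threshold]
    calc Real.log ((T : ℝ) ^ 2)
        = √((s.k : ℝ) / T) * √((T : ℝ) / s.k) * Real.log ((T : ℝ) ^ 2) := by rw [hs, one_mul]
      _ ≤ _ := by linarith
  have hexp : Real.exp (-(2 * (s.threshold T / 2) ^ 2 * s.macroLength T ((T : ℝ) ^ 2)⁻¹))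
      ≤ ((T : ℝ) ^ 2)⁻¹ := by
    rw [Real.exp_neg]
    refine inv_anti₀ (by positivity) ?_
    exact (Real.exp_log (show 0 < (T : ℝ) ^ 2 by positivity)).symm.le.trans
      (Real.exp_le_exp.2 he)
  rw [deviationBound_zero]
  calc _ ≤ (T : ℝ) * (2 * ((T : ℝ) ^ 2)⁻¹) := by gcongr
    _ = 2 / T := by field_simp
    _ ≤ 1 := by rw [div_le_one h1]; exact h2T

/-- The cost of a macrostep with `j` allocated intervals: its length, and one more for the
possibility that the estimate is not accurate. -/
def macroCost (T : ℕ) (j : ℕ) : ℝ :=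
  ⌈8 * √((T : ℝ) / j) * Real.log (((T : ℝ) ^ 2)⁻¹)⁻¹⌉₊ + 1

theorem macroCost_nonneg (T j : ℕ) : 0 ≤ macroCost T j := by unfold macroCost; positivity

theorem macroCost_anti (T : ℕ) (i j : ℕ) (hi : 1 ≤ i) (hij : i ≤ j) :
    macroCost T j ≤ macroCost T i := by
  have hi' : (0 : ℝ) < i := by exact_mod_cast hi
  have hl : 0 ≤ Real.log (((T : ℝ) ^ 2)⁻¹)⁻¹ := by
    rw [inv_inv, ← Nat.cast_pow]
    exact Real.log_natCast_nonneg _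
  unfold macroCost
  gcongr

/-- The regret of a macrostep and what follows, from any intermediate state. -/
theorem expectedRegret_macrostep_le {n : ℕ} {I : Instance n} {T : ℕ} (hT : 2 ≤ T) {δ : ℝ}
    {s : SearchState} (hk : 1 ≤ s.k) (hs : s.Nonneg) {r : ℝ} (hr1 : r ≤ 1)
    (hm : 0 < s.macroLength T δ) {R : ℝ} (hR : 0 ≤ R) {t₀ : ℕ} (ht₀ : t₀ ≤ T)
    (hnext : ∀ t < t₀, ∀ d, |d - I.demand (s.mid T)| < s.threshold T / 2 →
      expectedRegret (AlgState.price T) (AlgState.next T δ) I.demand r t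
        (AlgState.enter T (s.update T d)) ≤ R)
    (t : ℕ) (ht : t ≤ t₀) (o c : ℕ) (ho : o < s.macroLength T δ) :
    expectedRegret (AlgState.price T) (AlgState.next T δ) I.demand r t (.search s o c)
      ≤ (s.macroLength T δ - o)
        + T * deviationBound (s.macroLength T δ) (I.demand (s.mid T)) (s.threshold T / 2) o c
        + R := by
  set m := s.macroLength T δ with hmdef
  set q := I.demand (s.mid T) with hq
  have hε : 0 < s.threshold T / 2 := half_pos (threshold_pos (by omega) hk)
  have hq0 : 0 ≤ q := I.demand_nonneg _
  have hq1 : q ≤ 1 := I.demand_le_one _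
  induction t generalizing o c with
  | zero =>
    have h1 : (o : ℝ) ≤ m := by exact_mod_cast ho.le
    have h2 := mul_nonneg (Nat.cast_nonneg (α := ℝ) T)
      (deviationBound_nonneg m q (s.threshold T / 2) o c)
    simp only [expectedRegret]
    linarith
  | succ t ih =>
    have key : ∀ sold, expectedRegret (AlgState.price T) (AlgState.next T δ) I.demand r t
        (AlgState.next T δ (.search s o c) sold) ≤ (m - (o + 1 : ℕ))
          + T * deviationBound m q (s.threshold T / 2) (o + 1) (if sold then c + 1 else c) + R := by
      intro sold
      simp only [AlgState.next]
      by_cases hend : m ≤ o + 1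
      · rw [if_pos (by rwa [← hmdef])]
        have hom : m = o + 1 := by omega
        rw [← hom, sub_self, zero_add]
        generalize (if sold = true then c + 1 else c) = c'
        -- A good estimate leads on to `R`. After a bad one the deviation bound is at least 1, and
        -- its weight `T` pays for all remaining rounds.
        by_cases hgood : |(c' : ℝ) / m - q| < s.threshold T / 2
        · have := hnext t (by omega) _ hgood
          have h2 := mul_nonneg (Nat.cast_nonneg (α := ℝ) T)
            (deviationBound_nonneg m q (s.threshold T / 2) m c')
          linarith
        · have h1 := one_le_deviationBound hm hε (not_lt.1 hgood)
          have h2 := expectedRegret_le_horizon (T := T) (δ := δ) I.demand_nonneg I.demand_le_one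
            hr1 t (q := AlgState.enter T (s.update T ((c' : ℝ) / m)))
            (by rw [AlgState.searchState_enter]; exact hs.update T _)
          have h3 := mul_le_mul_of_nonneg_left h1 (Nat.cast_nonneg (α := ℝ) T)
          have h4 : (t : ℝ) ≤ T := by exact_mod_cast (by omega : t ≤ T)
          linarith
      · rw [if_neg (by rwa [← hmdef])]
        exact ih (by omega) _ _ (by omega)
    have k1 := mul_le_mul_of_nonneg_left (key true) hq0
    have k2 := mul_le_mul_of_nonneg_left (key false) (sub_nonneg.2 hq1)
    have hdev := mul_le_mul_of_nonneg_left
      (deviationBound_step hq0 hq1 m (s.threshold T / 2) o c) (Nat.cast_nonneg (α := ℝ) T)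
    have hpr : AlgState.price T (.search s o c) = s.mid T := rfl
    simp only [expectedRegret, hpr, ← hq]
    have hx := mul_nonneg (hs.mid T) hq0
    simp only [if_true, Bool.false_eq_true, if_false] at k1 k2
    push_cast at k1 k2
    linarith

/-- The regret from the start of a macrostep on is bounded by the cost of the remaining
macrosteps and the regret of the bandit phase. -/
theorem Invariant.expectedRegret_enter_le {n : ℕ} {I : Instance n} {T : ℕ} (hT : 2 ≤ T)
    {o : Fin (n + 1)} (hp : (((n : ℝ) + 1) / T) ^ (1 / 4 : ℝ) ≤ I.p o) {r : ℝ} (hr1 : r ≤ 1)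
    {B : ℝ} (hB0 : 0 ≤ B)
    (hB : ∀ s, Invariant I T o s → ¬ (s.wide T).Nonempty → ∀ t ≤ T,
      expectedRegret (AlgState.price T) (AlgState.next T ((T : ℝ) ^ 2)⁻¹) I.demand r t
        (.bandit s (fun _ => 0) (fun _ => 0)) ≤ B)
    (t : ℕ) (ht : t ≤ T) (s : SearchState) (h : Invariant I T o s) (hs : s.Nonneg) :
    expectedRegret (AlgState.price T) (AlgState.next T ((T : ℝ) ^ 2)⁻¹) I.demand r t
      (AlgState.enter T s) ≤ s.searchCost T (n + 1) (macroCost T) + B := by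
  have hT0 : 0 < T := by omega
  -- A macrostep consumes many rounds at once, hence strong induction.
  induction t using Nat.strong_induction_on generalizing s with
  | _ t ih =>
    unfold AlgState.enter
    by_cases hw : (s.wide T).Nonempty
    · rw [if_pos hw]
      have hmid := I.innerDemand_of_lt (h.mid_lt_one hT0 hw)
      have hstep : ∀ d, |d - I.demand (s.mid T)| < s.threshold T / 2 →
          Invariant I T o (s.update T d) ∧ (s.update T d).searchCost T (n + 1) (macroCost T)
            ≤ s.searchCost T (n + 1) (macroCost T) - macroCost T s.k := by
        intro d hd
        rw [← hmid] at hd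
        have hu := h.update hT0 hp hw hd
        have := h.searchCost_update hT0 hw hu (macroCost_nonneg T) (macroCost_anti T)
        exact ⟨hu, by linarith⟩
      -- Needed because the horizon may end inside the macrostep. It is obtained from the state that
      -- an exact estimate would produce.
      have hR : 0 ≤ s.searchCost T (n + 1) (macroCost T) - macroCost T s.k + B := by
        have h0 := hstep (I.demand (s.mid T))
          (by simpa using half_pos (threshold_pos hT0 h.k_pos))
        linarith [h0.1.searchCost_nonneg hT0 (macroCost_nonneg T) (n + 1), h0.2]
      have hm := macroLength_pos hT h.k_pos
      have := expectedRegret_macrostep_le hT h.k_pos hs hr1 hm hR ht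
        (fun t' ht' d hd => (ih t' ht' (by omega) _ (hstep d hd).1 (hs.update T d)).trans
          (by linarith [(hstep d hd).2])) t le_rfl 0 0 hm
      have hdev := mul_deviationBound_le_one hT h.k_pos (I.demand (s.mid T))
      have hc : macroCost T s.k = s.macroLength T ((T : ℝ) ^ 2)⁻¹ + 1 := rfl
      rw [hc] at this
      push_cast at this
      linarith
    · rw [if_neg hw]
      linarith [hB s h hw t ht, h.searchCost_nonneg hT0 (macroCost_nonneg T) (n + 1)]

end SearchState

/-! ### The additive constants and the final bound -/

namespace Instance

variable {n : ℕ} (I : Instance n)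

theorem vMin_pos : 0 < I.vMin := I.v_pos

theorem vMax_pos : 0 < I.vMax := I.v_pos' _

theorem minGap_le (j : Fin n) : I.minGap ≤ I.v j.succ - I.v j.castSucc :=
  ciInf_le (Set.finite_range _).bddBelow j

theorem minGap_pos (hn : n ≠ 0) : 0 < I.minGap := by
  have : Nonempty (Fin n) := ⟨⟨0, Nat.pos_of_ne_zero hn⟩⟩
  obtain ⟨j, hj⟩ := exists_eq_ciInf_of_finite (f := fun j : Fin n => I.v j.succ - I.v j.castSucc)
  rw [minGap, ← hj]
  exact sub_pos.2 (I.v_strictMono j.castSucc_lt_succ)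

theorem gap_zero : I.gap 0 = I.v 0 := by simp [gap]

theorem gap_succ (j : Fin n) : I.gap j.succ = I.v j.succ - I.v j.castSucc := by simp [gap]

theorem gap_pos (i : Fin (n + 1)) : 0 < I.gap i := by
  refine Fin.cases ?_ (fun j => ?_) i
  · rw [gap_zero]; exact I.v_pos
  · rw [gap_succ]; exact sub_pos.2 (I.v_strictMono j.castSucc_lt_succ)

theorem sum_gap : ∑ i, I.gap i = I.vMax := by
  rw [Fin.sum_univ_succ, gap_zero]
  simp only [gap_succ, Finset.sum_sub_distrib]
  have h := (Fin.sum_univ_succ I.v).symm.trans (Fin.sum_univ_castSucc I.v)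
  rw [vMax]
  linarith

theorem sharpConstant_nonneg : 0 ≤ I.sharpConstant := by
  have := I.vMin_pos
  have := I.vMax_pos
  unfold sharpConstant
  split_ifs with hn
  · positivity
  · have := I.minGap_pos hn
    positivity

/-- Let `g` be the smallest gap, `v_1` included. The gaps sum to `v_K ≤ 1`, so `K g ≤ 1`; both
fourth powers are at most `(v_K / g) ^ 4 ≤ V g`. One factor `g` absorbs `K`, the other is at most 1.
-/
theorem sharpConstant_le : I.sharpConstant ≤ I.bigV * (I.bigV + 1) := by
  obtain ⟨i, -, hi⟩ := Finset.univ.exists_min_image I.gap Finset.univ_nonempty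
  set g := I.gap i with hg
  have hg0 : 0 < g := I.gap_pos i
  have hM0 := I.vMax_pos
  have hV : I.vMax ^ 4 / g ^ 5 ≤ I.bigV :=
    Finset.le_sup' (fun i => I.vMax ^ 4 / I.gap i ^ 5) (Finset.mem_univ i)
  have hV0 : 0 ≤ I.bigV := le_trans (by positivity) hV
  have hX : (I.vMax / g) ^ 4 ≤ I.bigV * g := by
    have := mul_le_mul_of_nonneg_right hV hg0.le
    refine le_trans (le_of_eq ?_) this
    field_simp
  have hng : ((n : ℝ) + 1) * g ≤ 1 := by
    have := Finset.card_nsmul_le_sum Finset.univ I.gap g fun j hj => hi j hj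
    rw [sum_gap] at this
    simp only [Finset.card_univ, Fintype.card_fin, nsmul_eq_mul] at this
    push_cast at this
    exact this.trans I.v_le_one
  have hg1 : g ≤ 1 := by
    have : 0 ≤ (n : ℝ) * g := by positivity
    linarith
  have hA : (I.vMax / I.vMin) ^ 4 ≤ I.bigV * g := by
    refine le_trans ?_ hX
    have : g ≤ I.vMin := (hi 0 (Finset.mem_univ _)).trans_eq I.gap_zero
    have := I.vMin_pos
    gcongr
  have hB : (if n = 0 then 0 else I.vMax ^ 4 / I.minGap ^ 4) ≤ I.bigV * g := by
    split_ifs with hn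
    · positivity
    · refine le_trans ?_ hX
      have : Nonempty (Fin n) := ⟨⟨0, Nat.pos_of_ne_zero hn⟩⟩
      have : g ≤ I.minGap := le_ciInf fun j => by
        rw [← gap_succ]
        exact hi _ (Finset.mem_univ _)
      rw [div_pow]
      gcongr
  have hB0 : 0 ≤ (if n = 0 then 0 else I.vMax ^ 4 / I.minGap ^ 4) := by
    split_ifs with hn
    · exact le_rfl
    · have := I.minGap_pos hn
      positivity
  unfold sharpConstant
  calc _ ≤ ((n : ℝ) + 1) * (I.bigV * g) * (1 + I.bigV * g) := by gcongr
    _ = (((n : ℝ) + 1) * g) * (I.bigV * (1 + I.bigV * g)) := by ring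
    _ ≤ 1 * (I.bigV * (1 + I.bigV * 1)) := by gcongr
    _ = _ := by ring

theorem demand_le_demand_succ_add (j : Fin n) :
    I.demand (I.v j.castSucc) ≤ I.demand (I.v j.succ) + I.p j.castSucc := by
  have h : ∑ i, (if i = j.castSucc then I.p j.castSucc else 0) = I.p j.castSucc := by simp
  rw [demand, demand, ← h, ← Finset.sum_add_distrib]
  refine Finset.sum_le_sum fun i _ => ?_
  have := I.p_pos i
  simp only [I.v_strictMono.le_iff_le]
  by_cases hi : i = j.castSucc
  · subst hi
    simp
  · by_cases h1 : j.castSucc ≤ i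
    · have : j.succ ≤ i := Fin.castSucc_lt_iff_succ_le.1 (lt_of_le_of_ne h1 (Ne.symm hi))
      simp [h1, this, hi]
    · simp only [h1, hi, if_false, add_zero]
      split_ifs <;> linarith

theorem demand_last : I.demand (I.v (Fin.last n)) = I.p (Fin.last n) := by
  have : ∀ i, I.v (Fin.last n) ≤ I.v i ↔ i = Fin.last n := fun i => by
    rw [I.v_strictMono.le_iff_le, Fin.last_le_iff]
  simp [demand, this]

/-- A valuation that is an optimal price has a large probability, so that it cannot be rare unless
the horizon is bounded by the additive constant. -/
theorem horizon_le_sharpConstant {T : ℕ} (hT : 0 < T) {o : Fin (n + 1)}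
    (ho : ∀ i, I.v i * I.demand (I.v i) ≤ I.v o * I.demand (I.v o))
    (hp : I.p o < (((n : ℝ) + 1) / T) ^ (1 / 4 : ℝ)) : (T : ℝ) ≤ I.sharpConstant := by
  have hT' : (0 : ℝ) < T := by exact_mod_cast hT
  have hp0 := I.p_pos o
  have hmin := I.vMin_pos
  have hmax := I.vMax_pos
  have hp4 : T * I.p o ^ 4 ≤ (n : ℝ) + 1 := by
    have h4 := pow_le_pow_left₀ hp0.le hp.le 4
    rw [← Real.rpow_natCast (_ ^ _), ← Real.rpow_mul (by positivity)] at h4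
    norm_num at h4
    rw [le_div_iff₀ hT'] at h4
    linarith
  have hbound : ∀ Y : ℝ, 1 ≤ I.p o * Y → (T : ℝ) ≤ ((n : ℝ) + 1) * Y ^ 4 := by
    intro Y hY
    have h1 : 1 ≤ (I.p o * Y) ^ 4 := one_le_pow₀ hY
    have h2 : 0 ≤ Y ^ 4 := by positivity
    calc (T : ℝ) ≤ T * (I.p o * Y) ^ 4 := le_mul_of_one_le_right hT'.le h1
      _ = T * I.p o ^ 4 * Y ^ 4 := by ring
      _ ≤ _ := by gcongr
  -- Comparison with the price `v_1`, which always sells.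
  have hopt : I.vMin ≤ I.vMax * I.demand (I.v o) := by
    have h0 := ho 0
    rw [I.demand_of_le le_rfl, mul_one] at h0
    exact h0.trans (mul_le_mul_of_nonneg_right (I.v_le_vMax o) (I.demand_nonneg _))
  unfold sharpConstant
  have hA : 0 ≤ ((n : ℝ) + 1) * (I.vMax / I.vMin) ^ 4 := by positivity
  rcases Fin.eq_castSucc_or_eq_last o with ⟨j, rfl⟩ | rfl
  · have hn : n ≠ 0 := fun h => by subst h; exact j.elim0
    have hc := I.minGap_pos hn
    have hcj := I.minGap_le j
    rw [if_neg hn]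
    have h1 := ho j.succ
    have h2 := I.demand_le_demand_succ_add j
    have h3 := I.demand_nonneg (I.v j.castSucc)
    have hvs := I.v_pos' j.succ
    -- Raising the price to the next valuation loses only the buyers of mass `p o`. As this is no
    -- improvement, `D (v o)` times the gap is at most `v_K * p o`.
    have h4 : I.demand (I.v j.castSucc) * I.minGap ≤ I.vMax * I.p j.castSucc := by
      have a1 := mul_le_mul_of_nonneg_left hcj h3
      have a2 := mul_le_mul_of_nonneg_left h2 hvs.le
      have a3 := mul_le_mul_of_nonneg_right (I.v_le_vMax j.succ) hp0.le
      linarith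
    have h5 := mul_le_mul_of_nonneg_right hopt hc.le
    have h6 := mul_le_mul_of_nonneg_left h4 hmax.le
    have hY : 1 ≤ I.p j.castSucc * (I.vMax / I.vMin * (I.vMax / I.minGap)) := by
      rw [div_mul_div_comm, ← mul_div_assoc, one_le_div (by positivity)]
      linarith
    refine (hbound _ hY).trans ?_
    rw [mul_pow, ← mul_assoc, div_pow I.vMax I.minGap]
    exact mul_le_mul_of_nonneg_left (by linarith) hA
  -- For the top valuation the demand is `p o` itself, so no gap enters.
  · rw [demand_last] at hopt
    have hY : 1 ≤ I.p (Fin.last n) * (I.vMax / I.vMin) := by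
      rw [← mul_div_assoc, one_le_div hmin]
      linarith
    refine (hbound _ hY).trans (le_mul_of_one_le_right hA ?_)
    split_ifs with hn
    · simp
    · have := I.minGap_pos hn
      have : 0 ≤ I.vMax ^ 4 / I.minGap ^ 4 := by positivity
      linarith

end Instance

/-! ### Explicit bounds and assembly -/

theorem sum_inv_sqrt_le (m : ℕ) : ∑ j ∈ Finset.Icc 1 m, 1 / √(j : ℝ) ≤ 2 * √(m : ℝ) := by
  induction m with
  | zero => simp
  | succ m ih =>
    rw [Finset.sum_Icc_succ_top (by omega)]
    have hu : 0 < √((m : ℝ) + 1) := Real.sqrt_pos.2 (by positivity)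
    have hv : √(m : ℝ) ≤ √((m : ℝ) + 1) := Real.sqrt_le_sqrt (by linarith)
    have h1 := Real.sq_sqrt (show (0 : ℝ) ≤ (m : ℝ) + 1 by positivity)
    have h2 := Real.sq_sqrt (show (0 : ℝ) ≤ (m : ℝ) by positivity)
    have : 1 / √((m : ℝ) + 1) ≤ 2 * (√((m : ℝ) + 1) - √(m : ℝ)) := by
      rw [div_le_iff₀ hu]
      nlinarith [sq_nonneg (√((m : ℝ) + 1) - √(m : ℝ))]
    push_cast
    linarith

theorem halvings_one_le {T : ℕ} (hT : 2 ≤ T) : SearchState.halvings T 1 ≤ 5 / 2 * Real.log T := by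
  have hT' : (2 : ℝ) ≤ T := by exact_mod_cast hT
  have hl2 := Real.log_two_gt_d9
  have hl : Real.log 2 ≤ Real.log T := Real.log_le_log (by norm_num) hT'
  have hs : 0 < √(T : ℝ) := Real.sqrt_pos.2 (by linarith)
  rw [SearchState.halvings, mul_one, Real.logb, Real.log_mul (by norm_num) hs.ne',
    Real.log_sqrt (by linarith), div_le_iff₀ (by linarith)]
  -- The numerator is `log 2 + log T / 2 ≤ (3 / 2) log T`, and `3 / 2 ≤ (5 / 2) log 2`.
  nlinarith

/-- The factor 16 is 8 times the 2 from `log T ^ 2`; the summand 2 is the rounding up plus the unit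
for failure. -/
theorem macroCost_le {T : ℕ} (hT : 2 ≤ T) {j : ℕ} (hj : 1 ≤ j) :
    SearchState.macroCost T j ≤ 16 * √(T : ℝ) * Real.log T * (1 / √(j : ℝ)) + 2 := by
  have hl : 0 ≤ Real.log T := Real.log_natCast_nonneg T
  have hj' : 0 < √(j : ℝ) := Real.sqrt_pos.2 (by exact_mod_cast hj)
  have h := (Nat.ceil_lt_add_one
    (show 0 ≤ 8 * √((T : ℝ) / j) * Real.log (((T : ℝ) ^ 2)⁻¹)⁻¹ by
      rw [inv_inv, Real.log_pow]; positivity)).le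
  have e : 8 * √((T : ℝ) / j) * Real.log (((T : ℝ) ^ 2)⁻¹)⁻¹
      = 16 * √(T : ℝ) * Real.log T * (1 / √(j : ℝ)) := by
    rw [inv_inv, Real.log_pow, Real.sqrt_div (Nat.cast_nonneg T)]
    push_cast
    ring
  rw [e] at h
  unfold SearchState.macroCost
  rw [e]
  linarith

theorem searchCost_init_le {T : ℕ} (hT : 2 ≤ T) (n : ℕ) :
    SearchState.init.searchCost T (n + 1) (SearchState.macroCost T)
      ≤ 5 / 2 * Real.log T * (32 * Real.log T * √(((n : ℝ) + 1) * T) + 2 * ((n : ℝ) + 1)) := by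
  have hl : 0 ≤ Real.log T := Real.log_natCast_nonneg T
  have e : SearchState.init.searchCost T (n + 1) (SearchState.macroCost T)
      = SearchState.halvings T 1 * ∑ j ∈ Finset.Icc 1 (n + 1), SearchState.macroCost T j := by
    rw [← Finset.add_sum_Ioc_eq_sum_Icc (by omega : 1 ≤ n + 1), mul_add, Finset.mul_sum]
    simp [SearchState.searchCost, SearchState.init]
  have hsum : ∑ j ∈ Finset.Icc 1 (n + 1), SearchState.macroCost T j
      ≤ 32 * Real.log T * √(((n : ℝ) + 1) * T) + 2 * ((n : ℝ) + 1) := by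
    have h1 := Finset.sum_le_sum fun j (hj : j ∈ Finset.Icc 1 (n + 1)) =>
      macroCost_le hT (Finset.mem_Icc.1 hj).1
    rw [Finset.sum_add_distrib, ← Finset.mul_sum] at h1
    have h2 := mul_le_mul_of_nonneg_left (sum_inv_sqrt_le (n + 1))
      (show 0 ≤ 16 * √(T : ℝ) * Real.log T by positivity)
    rw [Real.sqrt_mul (by positivity)]
    simp only [Finset.sum_const, Nat.card_Icc, nsmul_eq_mul] at h1
    push_cast at h1 h2
    linarith
  rw [e]
  have h0 : 0 ≤ ∑ j ∈ Finset.Icc 1 (n + 1), SearchState.macroCost T j :=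
    Finset.sum_nonneg fun j _ => SearchState.macroCost_nonneg T j
  have := halvings_one_le hT
  gcongr

/-- The regret if the optimal valuation is frequent enough to be found. -/
theorem expectedRegret_le_of_frequent {n : ℕ} {I : Instance n} {T : ℕ} (hT : 2 ≤ T)
    {o : Fin (n + 1)} (hp : (((n : ℝ) + 1) / T) ^ (1 / 4 : ℝ) ≤ I.p o) :
    expectedRegret (AlgState.price T) (AlgState.next T ((T : ℝ) ^ 2)⁻¹) I.demand
        (I.v o * I.demand (I.v o)) T (AlgState.enter T SearchState.init)
      ≤ 120 * √(((n : ℝ) + 1) * T) * Real.log T ^ 2 := by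
  have hT0 : (0 : ℝ) < T := by exact_mod_cast (by omega : 0 < T)
  have hT2 : (2 : ℝ) ≤ T := by exact_mod_cast hT
  have hs : 0 < √(T : ℝ) := Real.sqrt_pos.2 hT0
  have hr1 : I.v o * I.demand (I.v o) ≤ 1 :=
    mul_le_one₀ (I.v_le_one' o) (I.demand_nonneg _) (I.demand_le_one _)
  have hl0 : 0 ≤ Real.log T := Real.log_natCast_nonneg T
  have hB : ∀ s, SearchState.Invariant I T o s → ¬ (s.wide T).Nonempty → ∀ t ≤ T,
      expectedRegret (AlgState.price T) (AlgState.next T ((T : ℝ) ^ 2)⁻¹) I.demand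
        (I.v o * I.demand (I.v o)) t (.bandit s (fun _ => 0) (fun _ => 0))
      ≤ √(T : ℝ) + 5 * ((n : ℝ) + 1) + 8 * √(Real.log T) * √(((n : ℝ) + 1) * T) := by
    intro s h hw t ht
    obtain ⟨i, hi, hio, hoi⟩ := h.target
    have ha1 : ∀ j ∈ s.live, s.a j ≤ 1 := fun j hj => by
      by_contra hc
      have hw := h.width j hj
      have := h.b_le_one j hj
      have := mul_nonpos_of_nonneg_of_nonpos hs.le (show s.b j - s.a j ≤ 0 by linarith)
      linarith
    have hb := expectedRegret_bandit_le (δ := ((T : ℝ) ^ 2)⁻¹) I.demand_nonneg I.demand_le_one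
      (fun j _ => h.a_nonneg j) ha1 hi (I.v o * I.demand (I.v o)) ht
    have hcard : (s.live.card : ℝ) ≤ (n : ℝ) + 1 := by exact_mod_cast h.card_live_le
    have hwi : s.b i - s.a i ≤ 1 / √(T : ℝ) := by
      by_contra hc
      refine hw ⟨i, Finset.mem_filter.2 ⟨hi, ?_⟩⟩
      rw [Real.rpow_neg hT0.le, ← Real.sqrt_eq_rpow, ← one_div]
      exact not_le.1 hc
    have hvo : I.v o ≤ s.b i := hoi.elim le_of_lt fun h => h ▸ I.v_le_one' o
    -- The left endpoint sells at least as often as `v o`, so only the price difference is lost.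
    have hloss : I.v o * I.demand (I.v o) - s.a i * I.demand (s.a i) ≤ 1 / √(T : ℝ) := by
      have h1 := mul_le_mul_of_nonneg_left (I.demand_antitone hio) (h.a_nonneg i)
      have h2 := mul_le_mul (show I.v o - s.a i ≤ 1 / √(T : ℝ) by linarith)
        (I.demand_le_one (I.v o)) (I.demand_nonneg _) (by positivity)
      linarith
    have hsq : (T : ℝ) * (1 / √(T : ℝ)) = √(T : ℝ) := by
      rw [mul_one_div, Real.div_sqrt]
    have htT : (t : ℝ) * (I.v o * I.demand (I.v o) - s.a i * I.demand (s.a i)) ≤ √(T : ℝ) := by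
      rw [← hsq]
      calc _ ≤ (t : ℝ) * (1 / √(T : ℝ)) := by gcongr
        _ ≤ _ := by gcongr
    have h3 : 8 * √(Real.log T) * √((s.live.card : ℝ) * T)
        ≤ 8 * √(Real.log T) * √(((n : ℝ) + 1) * T) := by gcongr
    linarith
  have hmain := SearchState.Invariant.expectedRegret_enter_le hT hp hr1 (by positivity) hB T le_rfl
    _ (SearchState.Invariant.init I hT o) SearchState.Nonneg.init
  refine hmain.trans ?_
  have hsearch := searchCost_init_le hT n
  -- A probability is at most 1, so the frequency assumption forces `K ≤ T`, and terms linear in `K`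
  -- are at most `√(K T)`.
  have hnT : (n : ℝ) + 1 ≤ T := by
    have hp1 : I.p o ≤ 1 := (I.p_le_demand le_rfl).trans (I.demand_le_one _)
    by_contra hc
    have : 1 < (((n : ℝ) + 1) / T) ^ (1 / 4 : ℝ) :=
      Real.one_lt_rpow ((one_lt_div hT0).2 (not_le.1 hc)) (by norm_num)
    linarith
  set Q := √(((n : ℝ) + 1) * T) with hQ
  have hnQ : (n : ℝ) + 1 ≤ Q := Real.le_sqrt_of_sq_le (by
    rw [sq]; exact mul_le_mul_of_nonneg_left hnT (by positivity))
  have hTQ : √(T : ℝ) ≤ Q := Real.sqrt_le_sqrt (le_mul_of_one_le_left hT0.le (by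
    have := Nat.cast_nonneg (α := ℝ) n
    linarith))
  have hl : 2 / 3 ≤ Real.log T := by
    have := Real.log_two_gt_d9
    have := Real.log_le_log (by norm_num) hT2
    linarith
  set l := Real.log T with hldef
  have hQ0 : 0 ≤ Q := Real.sqrt_nonneg _
  have hsl : √l ≤ (1 + l) / 2 := by
    have := Real.sq_sqrt hl0
    nlinarith [sq_nonneg (√l - 1)]
  have hl1 : 1 ≤ 3 / 2 * l := by linarith
  have hl2 : 1 ≤ 9 / 4 * l ^ 2 := by nlinarith
  have hll : l ≤ 3 / 2 * l ^ 2 := by nlinarith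
  have g1 : 5 / 2 * l * (32 * l * Q + 2 * ((n : ℝ) + 1))
      ≤ 80 * (l ^ 2 * Q) + 15 / 2 * (l ^ 2 * Q) := by
    have a1 := mul_le_mul_of_nonneg_left hnQ hl0
    have a2 := mul_le_mul_of_nonneg_right hll hQ0
    linarith
  have g2 : Q ≤ 9 / 4 * (l ^ 2 * Q) := by
    have := mul_le_mul_of_nonneg_right hl2 hQ0
    linarith
  have g3 : 8 * √l * Q ≤ 15 * (l ^ 2 * Q) := by
    have : 8 * √l ≤ 15 * l ^ 2 := by linarith
    have := mul_le_mul_of_nonneg_right this hQ0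
    linarith
  -- In units of `l ^ 2 * Q`: 87.5 for the search, 2.25 for `√T`, 11.25 for `5 K`, and 15 for UCB1,
  -- in total 116.
  linarith [mul_nonneg (sq_nonneg l) hQ0]

end PostedPrice

end


theorem theorem3 :
    ∃ (C : ℝ) (q : ℕ), ∀ (T : ℕ), 2 ≤ T → ∀ (n : ℕ) (I : PostedPrice.Instance n)
      (Ω : Type*) [MeasurableSpace Ω] (μ : MeasureTheory.Measure Ω)
      [MeasureTheory.IsProbabilityMeasure μ] (V : ℕ → Ω → ℝ),
      PostedPrice.IsIIDValuations I μ V →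
      PostedPrice.regret (PostedPrice.searchThenUCB T ((T : ℝ) ^ 2)⁻¹) μ V T
          ≤ C * √(((n : ℝ) + 1) * T) * Real.log T ^ q + I.bigV * (I.bigV + 1) ∧
      PostedPrice.regret (PostedPrice.searchThenUCB T ((T : ℝ) ^ 2)⁻¹) μ V T
          ≤ C * √(((n : ℝ) + 1) * T) * Real.log T ^ q + I.sharpConstant := by
  refine ⟨120, 2, fun T hT n I Ω _ μ _ V h => ?_⟩
  suffices hsharp : PostedPrice.regret (PostedPrice.searchThenUCB T ((T : ℝ) ^ 2)⁻¹) μ V T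
      ≤ 120 * √(((n : ℝ) + 1) * T) * Real.log T ^ 2 + I.sharpConstant from
    ⟨hsharp.trans (by linarith [I.sharpConstant_le]), hsharp⟩
  obtain ⟨o, -, ho⟩ := Finset.univ.exists_max_image (fun i => I.v i * I.demand (I.v i))
    Finset.univ_nonempty
  have ho' : ∀ i, I.v i * I.demand (I.v i) ≤ I.v o * I.demand (I.v o) :=
    fun i => ho i (Finset.mem_univ i)
  have hr0 : 0 ≤ I.v o * I.demand (I.v o) := mul_nonneg (I.v_pos' o).le (I.demand_nonneg _)
  refine (h.regret_le (PostedPrice.searchThenUCB T ((T : ℝ) ^ 2)⁻¹) T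
    (r := I.v o * I.demand (I.v o)) fun x hx _ => ?_).trans ?_
  -- Raising any price to the next valuation keeps its demand, so the best price may be taken among
  -- the valuations.
  · rcases I.demand_eq_zero_or x with h0 | ⟨i, hxi, hi⟩
    · rwa [h0, mul_zero]
    · rw [hi]
      exact (mul_le_mul_of_nonneg_right hxi (I.demand_nonneg _)).trans (ho' i)
  · change PostedPrice.expectedRegret (PostedPrice.AlgState.price T)
      (PostedPrice.AlgState.next T ((T : ℝ) ^ 2)⁻¹) I.demand _ T
      (PostedPrice.AlgState.enter T PostedPrice.SearchState.init) ≤ _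
    -- Either `v o` is frequent enough to be found, or the horizon itself is below the additive
    -- constant.
    by_cases hp : (((n : ℝ) + 1) / T) ^ (1 / 4 : ℝ) ≤ I.p o
    · linarith [PostedPrice.expectedRegret_le_of_frequent hT hp, I.sharpConstant_nonneg]
    · have h1 := PostedPrice.expectedRegret_le_horizon (T := T) (δ := ((T : ℝ) ^ 2)⁻¹)
        I.demand_nonneg I.demand_le_one
        (mul_le_one₀ (I.v_le_one' o) (I.demand_nonneg (I.v o)) (I.demand_le_one _)) T
        (q := PostedPrice.AlgState.enter T PostedPrice.SearchState.init) (by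
          rw [PostedPrice.AlgState.searchState_enter]
          exact PostedPrice.SearchState.Nonneg.init)
      have h2 := I.horizon_le_sharpConstant (by omega) ho' (not_le.1 hp)
      have h3 : 0 ≤ 120 * √(((n : ℝ) + 1) * T) * Real.log T ^ 2 := by positivity
      linarith
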